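/- Let $r\ge 1$ and let $\lambda=(\lambda_1,\dots,\lambda_{r+1})\in\mathbb{R}^{r+1}$ with $\lambda_1>\lambda_2>\dots>\lambda_{r+1}$. For $v\in S_{r+1}$ put $\lambda_v=(\lambda_{v(1)},\dots,\lambda_{v(r+1)})$, and let $\mathrm{Perm}(\lambda)$ be the convex hull of all $\lambda_v$, $v\in S_{r+1}$. Regard $S_r$ as the subgroup of $S_{r+1}$ fixing $r+1$, let $s_i$ be the transposition $(i\;\,i+1)$, and multiply permutations from right to left. For $u\in S_r$ let $I_u=[u,\,s_1s_2\cdots s_r u]$ be the interval in the (strong) Bruhat order of $S_{r+1}$, and let $\mathrm{Cube}_\lambda(u)$ be the convex hull of the points $\lambda_v$, $v\in I_u$. For a permutation $w=w_1\cdots w_r\in S_r$ and $i\in\{1,\dots,r\}$ let $f_i,g_i\ge 0$ be maximal such that $w_j<w_i$ for all $j$ in $L(w,i)=\{i-f_i,\dots,i-1\}\subseteq\{1,\dots,r\}$ and all $j$ in $R(w,i)=\{i+1,\dots,i+g_i\}\subseteq\{1,\dots,r\}$. (Thus $L(w,i)$ and $R(w,i)$ are the positions in $w$ of the labels in the left and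 right subtree of the node labelled $w_i$ in the decreasing binary tree of $w$.) Theorem. The $r!$ polytopes $\mathrm{Cube}_\lambda(u)$, $u\in S_r$, are pairwise distinct combinatorial cubes of dimension $r$ (their face lattices are isomorphic to that of $[0,1]^r$), and they are the maximal faces of a polyhedral subdivision of $\mathrm{Perm}(\lambda)$. Moreover, for $u\in S_r$ and $w=u^{-1}$, the facet description of $\mathrm{Cube}_\lambda(u)$ inside the hyperplane $t_1+\dots+t_{r+1}=\lambda_1+\dots+\lambda_{r+1}$ is given by the inequalities \begin{align*} \text{(left)}\quad & t_{w_i}+\sum_{j\in L(w,i)}t_{w_j}\ \le\ \lambda_{i-f_i}+\dots+\lambda_i,\\ \text{(right)}\quad & t_{w_i}+\sum_{j\in R(w,i)}t_{w_j}\ \ge\ \lambda_{i+1}+\dots+\lambda_{i+g_i+1}, \end{align*} for $i=1,\dots,r$: $\mathrm{Cube}_\lambda(u)$ is the set of all points $t$ of that hyperplane satisfying these $2r$ inequalities, and the $2r$ subsets of $\mathrm{Cube}_\lambda(u)$ on which one of them is an equality are pairwise distinct and are exactly its facets. -/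

import Mathlib

open scoped BigOperators

namespace CubeSubdivision

noncomputable section

/-! ### Permutations and Bruhat order

Positions and values are indexed from `0`: `Fin r` stands for `{1, …, r}` and `Fin (r + 1)` for
`{1, …, r + 1}`; the one-line notation of `v` is `v 0, v 1, …`. Products of permutations are read
from right to left. -/

/-- One upward step in Bruhat order: `w = v t` with `t` the transposition of two positions `i < j`
such that `v i < v j` (these are exactly the transpositions `t` for which `v t` has more
inversions than `v`). -/
def BruhatStep {n : ℕ} (v w : Equiv.Perm (Fin n)) : Prop :=
  ∃ i j : Fin n, i < j ∧ v i < v j ∧ w = v * Equiv.swap i j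

/-- The (strong) Bruhat order on the symmetric group. -/
def BruhatLE {n : ℕ} (v w : Equiv.Perm (Fin n)) : Prop :=
  Relation.ReflTransGen BruhatStep v w

/-- The embedding of `S_r` into `S_{r+1}` that fixes the last letter. -/
def embed {r : ℕ} (u : Equiv.Perm (Fin r)) : Equiv.Perm (Fin (r + 1)) where
  toFun := Fin.lastCases (Fin.last r) (fun i => (u i).castSucc)
  invFun := Fin.lastCases (Fin.last r) (fun i => (u⁻¹ i).castSucc)
  left_inv := by
    intro x
    induction x using Fin.lastCases <;> simp
  right_inv := by
    intro x
    induction x using Fin.lastCases <;> simp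

/-- The product `s_1 s_2 ⋯ s_r` of the adjacent transpositions of `S_{r+1}`, in this order. -/
def longCycle (r : ℕ) : Equiv.Perm (Fin (r + 1)) :=
  (List.ofFn fun i : Fin r => Equiv.swap i.castSucc i.succ).prod

/-- The Bruhat interval `I_u = [u, s_1 s_2 ⋯ s_r u]` in `S_{r+1}`, for `u ∈ S_r`. -/
def bruhatInterval {r : ℕ} (u : Equiv.Perm (Fin r)) : Set (Equiv.Perm (Fin (r + 1))) :=
  {v | BruhatLE (embed u) v ∧ BruhatLE v (longCycle r * embed u)}

/-! ### The permutahedron and the cubes -/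

/-- The point `λ_v = (λ_{v(1)}, …, λ_{v(n)})`. -/
def permPoint {n : ℕ} (lam : Fin n → ℝ) (v : Equiv.Perm (Fin n)) : Fin n → ℝ :=
  fun i => lam (v i)

/-- The permutahedron `Perm(λ)`. -/
def permutahedron {n : ℕ} (lam : Fin n → ℝ) : Set (Fin n → ℝ) :=
  convexHull ℝ (Set.range (permPoint lam))

/-- The Bruhat interval polytope `Cube_λ(u)`: the convex hull of the `λ_v` with `v ∈ I_u`. -/
def cube {r : ℕ} (lam : Fin (r + 1) → ℝ) (u : Equiv.Perm (Fin r)) : Set (Fin (r + 1) → ℝ) :=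
  convexHull ℝ (permPoint lam '' bruhatInterval u)

/-! ### Polytopes, faces, subdivisions -/

section Polytopes

variable {E F : Type*} [AddCommGroup E] [Module ℝ E] [TopologicalSpace E]
  [AddCommGroup F] [Module ℝ F] [TopologicalSpace F]

/-- A polytope is the convex hull of finitely many points. -/
def IsPolytope (P : Set E) : Prop :=
  ∃ s : Set E, s.Finite ∧ P = convexHull ℝ s

/-- The faces of a polytope `P`: the sets of maximizers over `P` of a linear functional (`P`
itself is one, for the functional `0`), together with the empty set. This is what `IsExposed`
says. -/
def IsFace (P G : Set E) : Prop := IsExposed ℝ P G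

/-- The facets of a polytope: its maximal proper faces. -/
def IsFacet (P G : Set E) : Prop := Maximal (fun H => IsFace P H ∧ H ≠ P) G

/-- The face lattice of a polytope: its faces, ordered by inclusion. -/
abbrev FaceLattice (P : Set E) : Type _ := {G : Set E // IsFace P G}

/-- Two polytopes are combinatorially equivalent if their face lattices are isomorphic. -/
def CombEquiv (P : Set E) (Q : Set F) : Prop :=
  Nonempty (FaceLattice P ≃o FaceLattice Q)

/-- A combinatorial `d`-cube is a polytope combinatorially equivalent to `[0, 1]^d`. -/
def IsCombinatorialCube (d : ℕ) (P : Set E) : Prop :=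
  IsPolytope P ∧ CombEquiv P (Set.Icc (0 : Fin d → ℝ) 1)

/-- `K` is a polyhedral subdivision of `P`: a polyhedral complex, that is, a finite collection of
polytopes that contains all faces of its members and in which any two members meet in a common
(possibly empty) face, with union `P`. -/
structure IsPolyhedralSubdivision (P : Set E) (K : Set (Set E)) : Prop where
  finite : K.Finite
  isPolytope : ∀ G ∈ K, IsPolytope G
  face_mem : ∀ G ∈ K, ∀ H, IsFace G H → H ∈ K
  inter_isFace : ∀ G ∈ K, ∀ H ∈ K, IsFace G (G ∩ H) ∧ IsFace H (G ∩ H)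
  union_eq : ⋃₀ K = P

end Polytopes

/-! ### The left and right inequalities -/

/-- `L(w, i)`: the largest set of consecutive positions `i - f, …, i - 1` immediately to the left
of `i` all of whose letters `w j` are smaller than `w i`. These are the positions of the letters
in the left subtree of the node `w i` of the decreasing binary tree of `w`. -/
def leftSet {r : ℕ} (w : Equiv.Perm (Fin r)) (i : Fin r) : Finset (Fin r) :=
  Finset.univ.filter fun j => j < i ∧ ∀ k, j ≤ k → k < i → w k < w i

/-- `R(w, i)`: the largest set of consecutive positions `i + 1, …, i + g` immediately to the right
of `i` all of whose letters `w j` are smaller than `w i`. These are the positions of the letters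
in the right subtree of the node `w i` of the decreasing binary tree of `w`. -/
def rightSet {r : ℕ} (w : Equiv.Perm (Fin r)) (i : Fin r) : Finset (Fin r) :=
  Finset.univ.filter fun j => i < j ∧ ∀ k, i < k → k ≤ j → w k < w i

/-- `t_{w_i} + ∑_{j ∈ L(w,i)} t_{w_j}`. -/
def leftForm {r : ℕ} (w : Equiv.Perm (Fin r)) (i : Fin r) (t : Fin (r + 1) → ℝ) : ℝ :=
  t (w i).castSucc + ∑ j ∈ leftSet w i, t (w j).castSucc

/-- `λ_{i-f} + ⋯ + λ_{i-1} + λ_i`, where `L(w,i) = {i - f, …, i - 1}`. -/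
def leftBound {r : ℕ} (lam : Fin (r + 1) → ℝ) (w : Equiv.Perm (Fin r)) (i : Fin r) : ℝ :=
  lam i.castSucc + ∑ j ∈ leftSet w i, lam j.castSucc

/-- `t_{w_i} + ∑_{j ∈ R(w,i)} t_{w_j}`. -/
def rightForm {r : ℕ} (w : Equiv.Perm (Fin r)) (i : Fin r) (t : Fin (r + 1) → ℝ) : ℝ :=
  t (w i).castSucc + ∑ j ∈ rightSet w i, t (w j).castSucc

/-- `λ_{i+1} + λ_{i+2} + ⋯ + λ_{i+g+1}`, where `R(w,i) = {i + 1, …, i + g}`. -/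
def rightBound {r : ℕ} (lam : Fin (r + 1) → ℝ) (w : Equiv.Perm (Fin r)) (i : Fin r) : ℝ :=
  lam i.succ + ∑ j ∈ rightSet w i, lam j.succ

/-- The `2r` inequalities of the facet description as a family of faces-to-be: the subset of `P`
on which the `i`-th left, respectively right, inequality of `w` is an equality. -/
def tightSet {r : ℕ} (P : Set (Fin (r + 1) → ℝ)) (lam : Fin (r + 1) → ℝ)
    (w : Equiv.Perm (Fin r)) : Fin r ⊕ Fin r → Set (Fin (r + 1) → ℝ)
  | Sum.inl i => {t ∈ P | leftForm w i t = leftBound lam w i}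
  | Sum.inr i => {t ∈ P | rightForm w i t = rightBound lam w i}

end

end CubeSubdivision

/-! Everything rests on one recursion: delete the first letter of a permutation. Write `u =
insertPerm i u'`, so that `u⁻¹` has its smallest letter in position `i`. The interval of `u`
consists of the words with first letter `i` or `i + 1` whose other letters are ordered as in a
member of the interval of `u'` (`insertPerm_mem_bruhatInterval`). For the inequalities, the smallest
letter contributes `λ_{i+1} ≤ t_0 ≤ λ_i`; once `t_0` is fixed, the others are those of `u'` for the
sequence `mergeAt lam i (t 0)`, in which `λ_i, λ_{i+1}` are replaced by `λ_i + λ_{i+1} - t_0` and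
which is again strictly decreasing (`mem_inequalityCube_insertPerm`). Both descriptions are thus the
same tower of segments (`cube_eq_inequalityCube`).

On a cube, the left and right slacks of a node have a positive sum (`slack_add_pos`), and this sum
can be split in prescribed ratios at all nodes at once (`exists_slack_eq`). So the sets of
simultaneously tight inequalities are those without an opposite pair, as for `[0,1]^r`;
`IsCubeSystem` turns this into the face lattice and the facets.

The subdivision uses the same recursion. A point majorized by `λ` finds its `i` from `t_0`, and its
tail is majorized by the merged sequence (`exists_mem_inequalityCube`). Two cubes meet where certain
inequalities of either one are tight (`exists_inter_iff_tight`), and a point with all slacks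
positive lies in only one cube (`eq_of_mem_of_slack_pos`). -/

namespace CubeSubdivision

/-! ### Polyhedra with the facial structure of a cube -/

section CubeSystem

variable {E F : Type*} [AddCommGroup E] [Module ℝ E] [TopologicalSpace E]
  [AddCommGroup F] [Module ℝ F] [TopologicalSpace F] {ι : Type*}

/-- The points of `P` at which all inequalities `f j ≤ b j` with `j ∈ T` are equalities. -/
def tightFace {κ : Type*} (P : Set E) (f : κ → StrongDual ℝ E) (b : κ → ℝ) (T : Set κ) : Set E :=
  {x ∈ P | ∀ j ∈ T, f j x = b j}

/-- The inequalities that are equalities on all of `G`. -/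
def tightIndices {κ : Type*} (f : κ → StrongDual ℝ E) (b : κ → ℝ) (G : Set E) : Set κ :=
  {j | ∀ x ∈ G, f j x = b j}

/-- `P` is cut out in a hyperplane by the inequalities `f j ≤ b j`, which come in pairs; the sets
of inequalities that are simultaneously tight at some point of `P` are exactly those that contain
no pair. -/
structure IsCubeSystem (P : Set E) (f : ι ⊕ ι → StrongDual ℝ E) (b : ι ⊕ ι → ℝ) : Prop where
  mem_iff : ∃ (φ : E →ₗ[ℝ] ℝ) (c : ℝ), ∀ x, x ∈ P ↔ φ x = c ∧ ∀ j, f j x ≤ b j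
  not_both : ∀ x ∈ P, ∀ i, f (.inl i) x = b (.inl i) → f (.inr i) x ≠ b (.inr i)
  exists_tight : ∀ T : Set (ι ⊕ ι), (∀ i, .inl i ∈ T → .inr i ∉ T) →
    ∃ x ∈ P, ∀ j, f j x = b j ↔ j ∈ T

namespace IsCubeSystem

variable {P : Set E} {f : ι ⊕ ι → StrongDual ℝ E} {b : ι ⊕ ι → ℝ}

theorem le (h : IsCubeSystem P f b) {x : E} (hx : x ∈ P) (j : ι ⊕ ι) : f j x ≤ b j := by
  obtain ⟨φ, c, H⟩ := h.mem_iff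
  exact ((H x).1 hx).2 j

theorem convex (h : IsCubeSystem P f b) : Convex ℝ P := by
  obtain ⟨φ, c, H⟩ := h.mem_iff
  intro x hx y hy s t hs ht hst
  rw [H] at *
  refine ⟨?_, fun j => ?_⟩
  · rw [map_add, map_smul, map_smul, hx.1, hy.1, ← add_smul, hst, one_smul]
  · rw [map_add, map_smul, map_smul, smul_eq_mul, smul_eq_mul]
    calc s * f j x + t * f j y ≤ s * b j + t * b j := by gcongr <;> simp [hx.2, hy.2]
      _ = b j := by rw [← add_mul, hst, one_mul]

/-- The exposing functional is the sum of the `f j` over `T`: once some point makes all of them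
tight, the maximizers are exactly such points. -/
theorem isExposed_tightFace [Finite ι] [ContinuousAdd E] (h : IsCubeSystem P f b)
    (T : Set (ι ⊕ ι)) : IsExposed ℝ P (tightFace P f b T) := by
  classical
  cases nonempty_fintype ι
  rintro ⟨x₀, hx₀, h₀⟩
  refine ⟨∑ j ∈ T.toFinite.toFinset, f j, ?_⟩
  ext x
  simp only [tightFace, Set.mem_ofPred_eq, FunLike.coe_sum, Finset.sum_apply]
  refine and_congr_right fun hx => ⟨fun H y hy => ?_, fun H j hj => ?_⟩
  · refine Finset.sum_le_sum fun j hj => ?_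
    rw [H j (by simpa using hj)]
    exact h.le hy j
  · have h1 : ∑ j ∈ T.toFinite.toFinset, f j x = ∑ j ∈ T.toFinite.toFinset, b j := by
      refine le_antisymm (Finset.sum_le_sum fun j _ => h.le hx j) ?_
      rw [← Finset.sum_congr rfl fun j hj => h₀ j (by simpa using hj)]
      exact H x₀ hx₀
    exact (Finset.sum_eq_sum_iff_of_le fun j _ => h.le hx j).1 h1 j (by simpa using hj)

/-- Some `z ∈ G` is tight only where all of `G` is. A segment from any `y` in the tight face to `z`
can be prolonged inside `P`, so extremality forces `y ∈ G`. -/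
theorem eq_tightFace_of_isExtreme [Finite ι] (h : IsCubeSystem P f b) {G : Set E}
    (hG : IsExtreme ℝ P G) (hc : Convex ℝ G) (hne : G.Nonempty) :
    G = tightFace P f b (tightIndices f b G) := by
  classical
  cases nonempty_fintype ι
  obtain ⟨φ, c, H⟩ := h.mem_iff
  refine Set.Subset.antisymm (fun x hx => ⟨hG.subset hx, fun j hj => hj x hx⟩) ?_
  -- Midpoints preserve strictness already achieved, so strict inequalities are collected one at a
  -- time.
  have key : ∀ S : Finset (ι ⊕ ι), (∀ j ∈ S, j ∉ tightIndices f b G) →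
      ∃ z ∈ G, ∀ j ∈ S, f j z < b j := by
    intro S
    induction S using Finset.induction_on with
    | empty => exact fun _ => ⟨hne.some, hne.some_mem, by simp⟩
    | insert a S _ ih =>
      intro hS
      obtain ⟨z, hz, hzS⟩ := ih fun j hj => hS j (Finset.mem_insert_of_mem hj)
      have ha := hS a (Finset.mem_insert_self a S)
      simp only [tightIndices, Set.mem_ofPred_eq, not_forall] at ha
      obtain ⟨y, hy, hya⟩ := ha
      refine ⟨(1 / 2 : ℝ) • z + (1 / 2 : ℝ) • y, hc hz hy (by norm_num) (by norm_num)
        (by norm_num), fun j hj => ?_⟩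
      rw [map_add, map_smul, map_smul, smul_eq_mul, smul_eq_mul]
      have hz' := h.le (hG.subset hz) j
      have hy' := h.le (hG.subset hy) j
      rcases Finset.mem_insert.1 hj with rfl | hj
      · have := lt_of_le_of_ne hy' hya
        linarith
      · have := hzS j hj
        linarith
  obtain ⟨z, hz, hzT⟩ := key (Finset.univ.filter (· ∉ tightIndices f b G)) (by simp)
  rintro y ⟨hy, hyT⟩
  -- Moving past `z`, away from `y`, leaves the tight inequalities tight and, for small `δ`, the
  -- strict ones valid.
  have hev : ∀ᶠ δ in nhdsWithin (0 : ℝ) (Set.Ioi 0), ∀ j, f j z + δ * (f j z - f j y) ≤ b j := by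
    rw [Filter.eventually_all]
    intro j
    by_cases hj : j ∈ tightIndices f b G
    · refine Filter.Eventually.of_forall fun δ => ?_
      rw [hj z hz, hyT j hj, sub_self, mul_zero, add_zero]
    · have h1 : Filter.Tendsto (fun δ : ℝ => f j z + δ * (f j z - f j y))
          (nhdsWithin 0 (Set.Ioi 0)) (nhds (f j z + 0 * (f j z - f j y))) :=
        (Continuous.tendsto (by fun_prop) 0).mono_left nhdsWithin_le_nhds
      refine (h1.eventually_lt_const ?_).mono fun δ hδ => hδ.le
      rw [zero_mul, add_zero]
      exact hzT j (by simpa using hj)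
  obtain ⟨δ, hδ, hδ0⟩ := (hev.and self_mem_nhdsWithin).exists
  have hδ0 : 0 < δ := hδ0
  have hyP := (H y).1 hy
  have hzP := (H z).1 (hG.subset hz)
  have hw : z + δ • (z - y) ∈ P := by
    refine (H _).2 ⟨?_, fun j => ?_⟩
    · rw [map_add, map_smul, map_sub, hyP.1, hzP.1, sub_self, smul_zero, add_zero]
    · rw [map_add, map_smul, map_sub, smul_eq_mul]
      exact hδ j
  refine hG.left_mem_of_mem_openSegment hy hw hz
    ⟨δ / (1 + δ), 1 / (1 + δ), by positivity, by positivity, by field_simp; ring, ?_⟩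
  have h1 : (1 + δ) ≠ 0 := by positivity
  have h2 : (1 : ℝ) / (1 + δ) + 1 / (1 + δ) * δ = 1 := by field_simp
  have h3 : δ / (1 + δ) - 1 / (1 + δ) * δ = 0 := by field_simp; ring
  calc (δ / (1 + δ)) • y + (1 / (1 + δ)) • (z + δ • (z - y))
      = (1 / (1 + δ) + 1 / (1 + δ) * δ) • z + (δ / (1 + δ) - 1 / (1 + δ) * δ) • y := by module
    _ = z := by rw [h2, h3, one_smul, zero_smul, add_zero]

theorem isExposed_of_isExtreme [Finite ι] [ContinuousAdd E] (h : IsCubeSystem P f b) {G : Set E}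
    (hG : IsExtreme ℝ P G) (hc : Convex ℝ G) : IsExposed ℝ P G := by
  rcases G.eq_empty_or_nonempty with rfl | hne
  · exact isExposed_empty
  · rw [h.eq_tightFace_of_isExtreme hG hc hne]
    exact h.isExposed_tightFace _

/-- Exposedness is not transitive for general convex sets. Extremality is, and here convex extreme
subsets are exposed. -/
theorem isExposed_trans [Finite ι] [ContinuousAdd E] (h : IsCubeSystem P f b) {G H : Set E}
    (hG : IsExposed ℝ P G) (hH : IsExposed ℝ G H) : IsExposed ℝ P H :=
  h.isExposed_of_isExtreme (hG.isExtreme.trans hH.isExtreme) (hH.convex (hG.convex h.convex))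

theorem eq_tightFace [Finite ι] (h : IsCubeSystem P f b) {G : Set E}
    (hG : IsExposed ℝ P G) (hne : G.Nonempty) : G = tightFace P f b (tightIndices f b G) :=
  h.eq_tightFace_of_isExtreme hG.isExtreme (hG.convex h.convex) hne

theorem finite_setOf_isExposed [Finite ι] (h : IsCubeSystem P f b) :
    {G | IsExposed ℝ P G}.Finite := by
  refine ((Set.finite_range (tightFace P f b)).union (Set.finite_singleton ∅)).subset
    fun G hG => ?_
  rcases G.eq_empty_or_nonempty with rfl | hne
  · exact Or.inr rfl
  · exact Or.inl ⟨_, (h.eq_tightFace hG hne).symm⟩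

theorem tightIndices_subset_iff [Finite ι] [Nonempty ι] (h : IsCubeSystem P f b) {G H : Set E}
    (hG : IsExposed ℝ P G) (hH : IsExposed ℝ P H) :
    tightIndices f b H ⊆ tightIndices f b G ↔ G ⊆ H := by
  refine ⟨fun hT => ?_, fun hGH j hj x hx => hj x (hGH hx)⟩
  rcases H.eq_empty_or_nonempty with rfl | hne
  -- For `H = ∅` every inequality is vacuously tight, so a point of `G` would make an opposite pair
  -- tight.
  · intro x hx
    have hj : ∀ j, f j x = b j := fun j => hT (by simp [tightIndices]) x hx
    exact (h.not_both x (hG.subset hx) (Classical.arbitrary ι) (hj _) (hj _)).elim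
  · rw [h.eq_tightFace hH hne]
    exact fun x hx => ⟨hG.subset hx, fun j hj => hT hj x hx⟩

theorem tightIndices_tightFace (h : IsCubeSystem P f b) {T : Set (ι ⊕ ι)}
    (hT : ∀ i, .inl i ∈ T → .inr i ∉ T) : tightIndices f b (tightFace P f b T) = T := by
  obtain ⟨x, hx, hxT⟩ := h.exists_tight T hT
  refine Set.Subset.antisymm (fun j hj => ?_) fun j hj y hy => hy.2 j hj
  exact (hxT j).1 (hj x ⟨hx, fun j hj => (hxT j).2 hj⟩)

/-- The face lattice, embedded into the sets of inequalities. -/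
def tightEmbedding [Finite ι] [Nonempty ι] (h : IsCubeSystem P f b) :
    FaceLattice P ↪o (Set (ι ⊕ ι))ᵒᵈ :=
  OrderEmbedding.ofMapLEIff (fun G => OrderDual.toDual (tightIndices f b G.1))
    fun G H => h.tightIndices_subset_iff G.2 H.2

/-- The image depends only on `ι`, so any two cube systems over `ι` have isomorphic face lattices;
`Set.univ` stands for the empty face. -/
theorem range_tightEmbedding [Finite ι] [Nonempty ι] [ContinuousAdd E]
    (h : IsCubeSystem P f b) : Set.range h.tightEmbedding =
      OrderDual.toDual '' ({T | ∀ i, .inl i ∈ T → .inr i ∉ T} ∪ {Set.univ}) := by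
  ext T
  constructor
  · rintro ⟨⟨G, hG⟩, rfl⟩
    refine ⟨tightIndices f b G, ?_, rfl⟩
    rcases G.eq_empty_or_nonempty with rfl | ⟨x, hx⟩
    · exact Or.inr (by simp [tightIndices])
    · exact Or.inl fun i hl hr => h.not_both x (hG.subset hx) i (hl x hx) (hr x hx)
  · rintro ⟨T, hT | rfl, rfl⟩
    · exact ⟨⟨_, h.isExposed_tightFace T⟩, h.tightIndices_tightFace hT⟩
    · refine ⟨⟨∅, isExposed_empty⟩, ?_⟩
      change OrderDual.toDual (tightIndices f b ∅) = _
      simp [tightIndices]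

theorem combEquiv [Finite ι] [Nonempty ι] [ContinuousAdd E] [ContinuousAdd F]
    (h : IsCubeSystem P f b) {Q : Set F} {g : ι ⊕ ι → StrongDual ℝ F} {c : ι ⊕ ι → ℝ}
    (h' : IsCubeSystem Q g c) : CombEquiv P Q :=
  ⟨h.tightEmbedding.orderIso.trans ((OrderIso.setCongr _ _
    (h.range_tightEmbedding.trans h'.range_tightEmbedding.symm)).trans
      h'.tightEmbedding.orderIso.symm)⟩

theorem tightFace_singleton_injective (h : IsCubeSystem P f b) :
    Function.Injective fun j => tightFace P f b {j} := by
  intro j k hjk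
  have := congrArg (tightIndices f b) hjk
  simp only at this
  rwa [h.tightIndices_tightFace (by rintro i rfl; simp),
    h.tightIndices_tightFace (by rintro i rfl; simp), Set.singleton_eq_singleton_iff] at this

/-- A proper face has some tight inequality, hence lies in a `tightFace` of a singleton; these are
proper and mutually incomparable. -/
theorem isFacet_iff [Finite ι] [Nonempty ι] [ContinuousAdd E] (h : IsCubeSystem P f b)
    {G : Set E} : IsFacet P G ↔ ∃ j, tightFace P f b {j} = G := by
  have hs : ∀ j : ι ⊕ ι, ∀ i, (.inl i : ι ⊕ ι) ∈ ({j} : Set (ι ⊕ ι)) → .inr i ∉ ({j} : Set _) := by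
    rintro j i rfl; simp
  have hP : tightIndices f b P = ∅ := by
    have := h.tightIndices_tightFace (T := ∅) (by simp)
    simpa [tightFace] using this
  have hproper : ∀ j, tightFace P f b {j} ≠ P := fun j hj => by
    have := h.tightIndices_tightFace (hs j)
    rw [hj, hP] at this
    exact (Set.singleton_ne_empty j) this.symm
  have hle : ∀ H, IsExposed ℝ P H → H ≠ P → ∃ j ∈ tightIndices f b H, H ⊆ tightFace P f b {j} := by
    intro H hH hHP
    by_contra! hcon
    have : tightIndices f b H = ∅ := by
      refine Set.eq_empty_of_forall_notMem fun j hj => hcon j hj fun x hx => ?_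
      exact ⟨hH.subset hx, by rintro _ rfl; exact hj x hx⟩
    refine hHP (Set.Subset.antisymm hH.subset ?_)
    rw [← h.tightIndices_subset_iff (IsExposed.refl P) hH, this]
    exact Set.empty_subset _
  constructor
  · rintro ⟨⟨hG, hGP⟩, hmax⟩
    obtain ⟨j, -, hj⟩ := hle G hG hGP
    exact ⟨j, Set.Subset.antisymm (hmax ⟨h.isExposed_tightFace _, hproper j⟩ hj) hj⟩
  · rintro ⟨j, rfl⟩
    refine ⟨⟨h.isExposed_tightFace _, hproper j⟩, ?_⟩
    rintro H ⟨hH, hHP⟩ hjH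
    obtain ⟨k, hk, hHk⟩ := hle H hH hHP
    have := (h.tightIndices_subset_iff (h.isExposed_tightFace {j}) hH).2 hjH hk
    rw [h.tightIndices_tightFace (hs j), Set.mem_singleton_iff] at this
    rwa [this] at hHk

end IsCubeSystem

/-- The standard cube. -/
theorem isCubeSystem_Icc (d : ℕ) : IsCubeSystem (Set.Icc (0 : Fin d → ℝ) 1)
    (Sum.elim (fun i => ContinuousLinearMap.proj i) (fun i => -ContinuousLinearMap.proj i))
    (Sum.elim (fun _ => 1) (fun _ => 0)) where
  mem_iff := by
    refine ⟨0, 0, fun x => ?_⟩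
    simp [Set.mem_Icc, Pi.le_def, and_comm]
  not_both x _ i := by
    simp only [Sum.elim_inl, Sum.elim_inr, ContinuousLinearMap.proj_apply,
      neg_apply]
    intro h1 h2
    linarith
  exists_tight T hT := by
    classical
    refine ⟨fun i => if .inl i ∈ T then 1 else if .inr i ∈ T then 0 else 1 / 2, ?_, ?_⟩
    · constructor <;> intro i <;> simp only [Pi.zero_apply, Pi.one_apply] <;> split_ifs <;> norm_num
    · rintro (i | i)
      · simp only [Sum.elim_inl, ContinuousLinearMap.proj_apply]
        split_ifs <;> simp_all
      · simp only [Sum.elim_inr, ContinuousLinearMap.proj_apply, neg_apply]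
        split_ifs with h1 h2 <;> simp_all

end CubeSystem

/-- A face of a polytope is a polytope. -/
theorem IsFace.isPolytope {n : ℕ} {P G : Set (Fin n → ℝ)} (hP : IsPolytope P) (h : IsFace P G) :
    IsPolytope G := by
  obtain ⟨s, hs, rfl⟩ := hP
  have hG : IsExposed ℝ (convexHull ℝ s) G := h
  -- Extreme points of the face lie in `s`; Krein–Milman then recovers the face, and the closure is
  -- harmless for a finite set.
  have hfin : (G.extremePoints ℝ).Finite := hs.subset
    (hG.isExtreme.extremePoints_subset_extremePoints.trans extremePoints_convexHull_subset)
  refine ⟨_, hfin, ?_⟩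
  rw [← (hfin.isClosed_convexHull ℝ).closure_eq]
  exact (closure_convexHull_extremePoints (hG.isCompact (hs.isCompact_convexHull ℝ))
    (hG.convex (convex_convexHull ℝ s))).symm

/-! ### Deleting the first letter of a permutation -/

/-- The permutation with first letter `p` whose other letters are ordered as in `v`. -/
def insertPerm {n : ℕ} (p : Fin (n + 1)) (v : Equiv.Perm (Fin n)) : Equiv.Perm (Fin (n + 1)) :=
  (finSuccEquiv' 0).trans ((Equiv.optionCongr v).trans (finSuccEquiv' p).symm)

@[simp]
theorem insertPerm_zero {n : ℕ} (p : Fin (n + 1)) (v : Equiv.Perm (Fin n)) :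
    insertPerm p v 0 = p := by
  simp [insertPerm]

@[simp]
theorem insertPerm_succ {n : ℕ} (p : Fin (n + 1)) (v : Equiv.Perm (Fin n)) (j : Fin n) :
    insertPerm p v j.succ = p.succAbove (v j) := by
  have : finSuccEquiv' (0 : Fin (n + 1)) j.succ = some j := finSuccEquiv'_succAbove 0 j
  simp [insertPerm, this]

@[simp]
theorem insertPerm_inv_self {n : ℕ} (p : Fin (n + 1)) (v : Equiv.Perm (Fin n)) :
    (insertPerm p v)⁻¹ p = 0 := by
  rw [Equiv.Perm.inv_eq_iff_eq, insertPerm_zero]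

@[simp]
theorem insertPerm_inv_succAbove {n : ℕ} (p : Fin (n + 1)) (v : Equiv.Perm (Fin n)) (j : Fin n) :
    (insertPerm p v)⁻¹ (p.succAbove j) = (v⁻¹ j).succ := by
  rw [Equiv.Perm.inv_eq_iff_eq, insertPerm_succ]
  simp

theorem exists_insertPerm {n : ℕ} (v : Equiv.Perm (Fin (n + 1))) :
    ∃ p v', v = insertPerm p v' := by
  have h : ∀ j : Fin n, ∃ k, (v 0).succAbove k = v j.succ := fun j =>
    Fin.exists_succAbove_eq (by simp)
  choose g hg using h
  have hinj : Function.Injective g := fun j k hjk => by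
    have := hg j
    rw [hjk, hg k] at this
    exact (Fin.succ_injective _ (v.injective this)).symm
  refine ⟨v 0, Equiv.ofBijective g (Finite.injective_iff_bijective.1 hinj), ?_⟩
  ext j
  induction j using Fin.cases with
  | zero => simp
  | succ j => simp [hg]

theorem insertPerm_mul_swap {n : ℕ} (p : Fin (n + 1)) (v : Equiv.Perm (Fin n)) (a b : Fin n) :
    insertPerm p (v * Equiv.swap a b) = insertPerm p v * Equiv.swap a.succ b.succ := by
  ext j
  induction j using Fin.cases with
  | zero =>
    rw [Equiv.Perm.mul_apply, Equiv.swap_apply_of_ne_of_ne (Fin.succ_ne_zero a).symm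
      (Fin.succ_ne_zero b).symm]
    simp
  | succ j =>
    rw [Equiv.Perm.mul_apply, ← (Fin.succ_injective n).map_swap]
    simp

theorem insertPerm_inj {n : ℕ} {p q : Fin (n + 1)} {v w : Equiv.Perm (Fin n)} :
    insertPerm p v = insertPerm q w ↔ p = q ∧ v = w := by
  refine ⟨fun h => ?_, by rintro ⟨rfl, rfl⟩; rfl⟩
  have h0 := congrArg (fun x : Equiv.Perm _ => x 0) h
  simp only [insertPerm_zero] at h0
  subst h0
  refine ⟨rfl, Equiv.ext fun j => ?_⟩
  have hj := congrArg (fun x : Equiv.Perm _ => x j.succ) h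
  simpa using hj

@[simp]
theorem embed_castSucc {r : ℕ} (u : Equiv.Perm (Fin r)) (j : Fin r) :
    embed u j.castSucc = (u j).castSucc := by
  simp [embed]

@[simp]
theorem embed_last {r : ℕ} (u : Equiv.Perm (Fin r)) : embed u (Fin.last r) = Fin.last r := by
  simp [embed]

theorem embed_insertPerm {n : ℕ} (i : Fin (n + 1)) (u : Equiv.Perm (Fin n)) :
    embed (insertPerm i u) = insertPerm i.castSucc (embed u) := by
  ext j
  congr 1
  induction j using Fin.lastCases with
  | last =>
    rw [embed_last, ← Fin.succ_last, insertPerm_succ]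
    simp
  | cast j =>
    induction j using Fin.cases with
    | zero => rw [embed_castSucc]; simp
    | succ j =>
      rw [embed_castSucc, ← Fin.succ_castSucc, insertPerm_succ]
      simp

/-- All factors after the first fix `0` and form a shifted copy of the shorter product. -/
theorem longCycle_succ (r : ℕ) :
    longCycle (r + 1) = Equiv.swap 0 1 * insertPerm 0 (longCycle r) := by
  have h : ∀ l : List (Fin r), (l.map fun i => Equiv.swap i.succ.castSucc i.succ.succ).prod =
      insertPerm 0 (l.map fun i => Equiv.swap i.castSucc i.succ).prod := by
    intro l
    induction l with
    | nil =>
      ext j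
      induction j using Fin.cases <;> simp
    | cons a l ih =>
      rw [List.map_cons, List.prod_cons, ih, List.map_cons, List.prod_cons]
      ext j
      congr 1
      induction j using Fin.cases with
      | zero =>
        rw [Equiv.Perm.mul_apply, insertPerm_zero, insertPerm_zero,
          Equiv.swap_apply_of_ne_of_ne] <;> simp [Fin.ext_iff]
      | succ j =>
        rw [Equiv.Perm.mul_apply, insertPerm_succ, insertPerm_succ, Equiv.Perm.mul_apply,
          Fin.zero_succAbove, Fin.zero_succAbove, (Fin.succ_injective _).map_swap,
          Fin.succ_castSucc]
  rw [longCycle, List.ofFn_succ, List.prod_cons, longCycle, List.ofFn_eq_map, List.ofFn_eq_map, h]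
  rfl

theorem longCycle_castSucc {r : ℕ} (j : Fin r) : longCycle r j.castSucc = j.succ := by
  induction r with
  | zero => exact j.elim0
  | succ r ih =>
    rw [longCycle_succ, Equiv.Perm.mul_apply]
    induction j using Fin.cases with
    | zero => simp
    | succ j =>
      rw [← Fin.succ_castSucc, insertPerm_succ, ih, Fin.zero_succAbove,
        Equiv.swap_apply_of_ne_of_ne] <;> simp [Fin.ext_iff]

theorem longCycle_last (r : ℕ) : longCycle r (Fin.last r) = 0 := by
  induction r with
  | zero => rfl
  | succ r ih =>
    rw [longCycle_succ, Equiv.Perm.mul_apply, ← Fin.succ_last, insertPerm_succ, ih]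
    simp

/-- With `embed_insertPerm`: the first letters of the two ends of the interval differ by exactly
one, and deleting them gives the ends of the smaller interval. -/
theorem longCycle_mul_embed_insertPerm {n : ℕ} (i : Fin (n + 1)) (u : Equiv.Perm (Fin n)) :
    longCycle (n + 1) * embed (insertPerm i u) = insertPerm i.succ (longCycle n * embed u) := by
  ext j
  congr 1
  rw [Equiv.Perm.mul_apply]
  induction j using Fin.lastCases with
  | last =>
    rw [embed_last, longCycle_last, ← Fin.succ_last, insertPerm_succ]
    simp [longCycle_last]
  | cast j =>
    induction j using Fin.cases with
    | zero => rw [embed_castSucc, longCycle_castSucc]; simp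
    | succ j =>
      rw [embed_castSucc, longCycle_castSucc, ← Fin.succ_castSucc, insertPerm_succ]
      simp [longCycle_castSucc]

/-! ### The Bruhat intervals -/

theorem bruhatStep_insertPerm {n : ℕ} {v w : Equiv.Perm (Fin n)} (h : BruhatStep v w)
    (p : Fin (n + 1)) : BruhatStep (insertPerm p v) (insertPerm p w) := by
  obtain ⟨a, b, hab, hv, rfl⟩ := h
  refine ⟨a.succ, b.succ, Fin.succ_lt_succ_iff.2 hab, ?_, insertPerm_mul_swap p v a b⟩
  simpa [Fin.succAbove_lt_succAbove_iff] using hv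

theorem bruhatLE_insertPerm {n : ℕ} {v w : Equiv.Perm (Fin n)} (h : BruhatLE v w)
    (p : Fin (n + 1)) : BruhatLE (insertPerm p v) (insertPerm p w) :=
  Relation.ReflTransGen.lift (insertPerm p) (fun _ _ h => bruhatStep_insertPerm h p) _ _ h

theorem bruhatStep_castSucc_succ {n : ℕ} (i : Fin n) (v : Equiv.Perm (Fin n)) :
    BruhatStep (insertPerm i.castSucc v) (insertPerm i.succ v) := by
  -- When the first letter is `i`, the value `i + 1` sits in position `(v⁻¹ i).succ`; the step
  -- exchanges these two values.
  refine ⟨0, (v⁻¹ i).succ, Fin.succ_pos _, by simp, ?_⟩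
  ext j
  congr 1
  rw [Equiv.Perm.mul_apply]
  induction j using Fin.cases with
  | zero => simp
  | succ j =>
    by_cases hj : v j = i
    · subst hj
      simp
    · rw [Equiv.swap_apply_of_ne_of_ne (Fin.succ_ne_zero j)
        (by rwa [Ne, Fin.succ_inj, Equiv.Perm.eq_inv_iff_eq]), insertPerm_succ, insertPerm_succ]
      have hj : (v j : ℕ) ≠ i := fun h => hj (Fin.ext h)
      simp only [Fin.succAbove, Fin.lt_def, Fin.val_castSucc, Fin.val_succ, Fin.ext_iff]
      split_ifs <;> simp <;> omega

theorem BruhatStep.of_insertPerm {n : ℕ} {p q : Fin (n + 1)} {v w : Equiv.Perm (Fin n)}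
    (h : BruhatStep (insertPerm p v) (insertPerm q w)) :
    p ≤ q ∧ ((q : ℕ) ≤ p + 1 → BruhatLE v w) := by
  obtain ⟨a, b, hab, hv, he⟩ := h
  have hb : b ≠ 0 := (lt_of_le_of_lt (Fin.zero_le a) hab).ne'
  obtain ⟨b, rfl⟩ := Fin.exists_succ_eq.2 hb
  induction a using Fin.cases with
  | succ a =>
    rw [← insertPerm_mul_swap, insertPerm_inj] at he
    obtain ⟨rfl, rfl⟩ := he
    refine ⟨le_rfl, fun _ => Relation.ReflTransGen.single ⟨a, b, by simpa using hab, ?_, rfl⟩⟩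
    simpa [Fin.succAbove_lt_succAbove_iff] using hv
  | zero =>
    have h0 := congrArg (fun x : Equiv.Perm _ => x 0) he
    simp only [insertPerm_zero, Equiv.Perm.mul_apply, Equiv.swap_apply_left, insertPerm_succ]
      at h0 hv
    -- A step that moves the first letter raises it. Raising it by only one exchanges adjacent
    -- values, which leaves the relative order of the other letters unchanged.
    refine ⟨h0 ▸ hv.le, fun hq => ?_⟩
    have hvw : v = w := by
      ext j
      have hj := congrArg (fun x : Equiv.Perm _ => x j.succ) he
      simp only [insertPerm_succ, Equiv.Perm.mul_apply] at hj
      have hvb : (v b : ℕ) = v j → b = j := fun h => v.injective (Fin.ext h)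
      by_cases hjb : b = j
      · subst hjb
        rw [Equiv.swap_apply_right, insertPerm_zero] at hj
        simp only [Fin.succAbove, Fin.lt_def, Fin.val_castSucc, Fin.ext_iff] at hj h0 hv
        split_ifs at hj h0 hv <;> simp at hj h0 hv <;> omega
      · rw [Equiv.swap_apply_of_ne_of_ne (Fin.succ_ne_zero j)
          (by rw [Ne, Fin.succ_inj]; exact fun h => hjb h.symm), insertPerm_succ] at hj
        have hne : (v b : ℕ) ≠ v j := fun h => hjb (hvb h)
        simp only [Fin.succAbove, Fin.lt_def, Fin.val_castSucc, Fin.ext_iff] at hj h0 hv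
        split_ifs at hj h0 hv <;> simp at hj h0 hv <;> omega
    rw [hvw]
    exact Relation.ReflTransGen.refl

/-- First letters increase weakly along a chain, so a total rise of at most one bounds the rise of
every step. The bound matters: `132 < 312`, but deletion gives `21 > 12`. -/
theorem BruhatLE.of_insertPerm {n : ℕ} {p q : Fin (n + 1)} {v w : Equiv.Perm (Fin n)}
    (h : BruhatLE (insertPerm p v) (insertPerm q w)) :
    p ≤ q ∧ ((q : ℕ) ≤ p + 1 → BruhatLE v w) := by
  generalize hx : insertPerm p v = x at h
  generalize hy : insertPerm q w = y at h
  induction h generalizing q w with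
  | refl =>
    rw [← hy, insertPerm_inj] at hx
    obtain ⟨rfl, rfl⟩ := hx
    exact ⟨le_rfl, fun _ => Relation.ReflTransGen.refl⟩
  | @tail y z _ hyz ih =>
    obtain ⟨q', w', rfl⟩ := exists_insertPerm y
    subst hy
    obtain ⟨h1, h2⟩ := ih rfl
    obtain ⟨h3, h4⟩ := hyz.of_insertPerm
    have h1' : (p : ℕ) ≤ q' := h1
    have h3' : (q' : ℕ) ≤ q := h3
    exact ⟨h1.trans h3, fun hq => (h2 (by omega)).trans (h4 (by omega))⟩

theorem insertPerm_mem_bruhatInterval {n : ℕ} {i : Fin (n + 1)} {u : Equiv.Perm (Fin n)}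
    {p : Fin (n + 2)} {v : Equiv.Perm (Fin (n + 1))} :
    insertPerm p v ∈ bruhatInterval (insertPerm i u) ↔
      (p = i.castSucc ∨ p = i.succ) ∧ v ∈ bruhatInterval u := by
  have hI : bruhatInterval (insertPerm i u) = {v | BruhatLE (insertPerm i.castSucc (embed u)) v ∧
      BruhatLE v (insertPerm i.succ (longCycle n * embed u))} := by
    rw [bruhatInterval, longCycle_mul_embed_insertPerm, embed_insertPerm]
  rw [hI]
  constructor
  · rintro ⟨h1, h2⟩
    obtain ⟨h1, h1'⟩ := h1.of_insertPerm
    obtain ⟨h2, h2'⟩ := h2.of_insertPerm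
    simp only [Fin.le_def, Fin.val_castSucc, Fin.val_succ] at h1 h1' h2 h2'
    refine ⟨?_, h1' (by omega), h2' (by omega)⟩
    simp only [Fin.ext_iff, Fin.val_castSucc, Fin.val_succ]
    omega
  · rintro ⟨rfl | rfl, h1, h2⟩
    · exact ⟨bruhatLE_insertPerm h1 _, (bruhatLE_insertPerm h2 _).tail (bruhatStep_castSucc_succ i _)⟩
    · exact ⟨(Relation.ReflTransGen.single (bruhatStep_castSucc_succ i _)).trans
        (bruhatLE_insertPerm h1 _), bruhatLE_insertPerm h2 _⟩

/-! ### Recursion for the left and right inequalities -/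

section Sets

variable {n : ℕ} (i : Fin (n + 1)) (u : Equiv.Perm (Fin n)) (j : Fin n)

theorem leftSet_insertPerm_self : leftSet (insertPerm i u)⁻¹ i = ∅ := by
  refine Finset.eq_empty_of_forall_notMem fun k hk => ?_
  simp only [leftSet, Finset.mem_filter, insertPerm_inv_self] at hk
  exact absurd (hk.2.2 k le_rfl hk.2.1) (Fin.not_lt_zero _)

theorem rightSet_insertPerm_self : rightSet (insertPerm i u)⁻¹ i = ∅ := by
  refine Finset.eq_empty_of_forall_notMem fun k hk => ?_
  simp only [rightSet, Finset.mem_filter, insertPerm_inv_self] at hk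
  exact absurd (hk.2.2 k hk.2.1 le_rfl) (Fin.not_lt_zero _)

/-- The smallest letter, in position `i`, never interrupts a run of smaller letters. -/
theorem succAbove_mem_leftSet (k : Fin n) :
    i.succAbove k ∈ leftSet (insertPerm i u)⁻¹ (i.succAbove j) ↔ k ∈ leftSet u⁻¹ j := by
  simp only [leftSet, Finset.mem_filter, Finset.mem_univ, true_and, Fin.forall_iff_succAbove i,
    Fin.succAbove_lt_succAbove_iff, Fin.succAbove_le_succAbove_iff, insertPerm_inv_self,
    insertPerm_inv_succAbove, Fin.succ_pos, Fin.succ_lt_succ_iff, implies_true]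

theorem succAbove_mem_rightSet (k : Fin n) :
    i.succAbove k ∈ rightSet (insertPerm i u)⁻¹ (i.succAbove j) ↔ k ∈ rightSet u⁻¹ j := by
  simp only [rightSet, Finset.mem_filter, Finset.mem_univ, true_and, Fin.forall_iff_succAbove i,
    Fin.succAbove_lt_succAbove_iff, Fin.succAbove_le_succAbove_iff, insertPerm_inv_self,
    insertPerm_inv_succAbove, Fin.succ_pos, Fin.succ_lt_succ_iff, implies_true]

/-- The smallest letter belongs to a left run exactly when its right neighbour `k` is in the run or
is its root. On the other side, `self_mem_rightSet` uses the left neighbour. -/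
theorem self_mem_leftSet :
    i ∈ leftSet (insertPerm i u)⁻¹ (i.succAbove j) ↔
      ∃ k : Fin n, k.castSucc = i ∧ (k = j ∨ k ∈ leftSet u⁻¹ j) := by
  have hle : ∀ k : Fin n, i ≤ i.succAbove k ↔ i ≤ k.castSucc := fun k => by
    rw [← Fin.lt_succAbove_iff_le_castSucc, le_iff_lt_or_eq]
    simp [Fin.ne_succAbove]
  simp only [leftSet, Finset.mem_filter, Finset.mem_univ, true_and, Fin.forall_iff_succAbove i,
    Fin.succAbove_lt_succAbove_iff, insertPerm_inv_self, insertPerm_inv_succAbove, Fin.succ_pos,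
    Fin.lt_succAbove_iff_le_castSucc, hle, Fin.succ_lt_succ_iff, implies_true]
  constructor
  · rintro ⟨h1, h2⟩
    have hi : (i : ℕ) < n := lt_of_le_of_lt (Fin.le_def.1 h1) j.2
    refine ⟨⟨i, hi⟩, rfl, ?_⟩
    rcases (Fin.le_def.1 h1).eq_or_lt with h | h
    · exact Or.inl (Fin.ext h)
    · exact Or.inr ⟨h, fun k hk hkj => h2 k hk hkj⟩
  · rintro ⟨k, rfl, rfl | ⟨h1, h2⟩⟩
    · exact ⟨le_rfl, fun k' h h' => absurd h' (not_lt.2 h)⟩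
    · exact ⟨h1.le, fun k' h h' => h2 k' h h'⟩

theorem self_mem_rightSet :
    i ∈ rightSet (insertPerm i u)⁻¹ (i.succAbove j) ↔
      ∃ k : Fin n, k.succ = i ∧ (k = j ∨ k ∈ rightSet u⁻¹ j) := by
  have hle : ∀ k : Fin n, i.succAbove k ≤ i ↔ k.succ ≤ i := fun k => by
    rw [← Fin.succAbove_lt_iff_succ_le, le_iff_lt_or_eq]
    simp [Fin.succAbove_ne]
  simp only [rightSet, Finset.mem_filter, Finset.mem_univ, true_and, Fin.forall_iff_succAbove i,
    Fin.succAbove_lt_succAbove_iff, insertPerm_inv_self, insertPerm_inv_succAbove, Fin.succ_pos,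
    Fin.succAbove_lt_iff_succ_le, hle, Fin.succ_lt_succ_iff, implies_true]
  constructor
  · rintro ⟨h1, h2⟩
    have hi : i ≠ 0 := (lt_of_lt_of_le (Fin.succ_pos j) h1).ne'
    obtain ⟨k, rfl⟩ := Fin.exists_succ_eq.2 hi
    refine ⟨k, rfl, ?_⟩
    rcases (Fin.succ_le_succ_iff.1 h1).eq_or_lt with h | h
    · exact Or.inl h.symm
    · exact Or.inr ⟨h, fun k' hj hk => h2 k' hj (Fin.succ_le_succ_iff.2 hk)⟩
  · rintro ⟨k, rfl, rfl | ⟨h1, h2⟩⟩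
    · exact ⟨le_rfl, fun k' h h' => absurd h (not_lt.2 (Fin.succ_le_succ_iff.1 h'))⟩
    · exact ⟨Fin.succ_le_succ_iff.2 h1.le, fun k' h h' => h2 k' h (Fin.succ_le_succ_iff.1 h')⟩

theorem sum_leftSet_succAbove (g : Fin (n + 1) → ℝ) :
    ∑ k ∈ leftSet (insertPerm i u)⁻¹ (i.succAbove j), g k =
      (if i ∈ leftSet (insertPerm i u)⁻¹ (i.succAbove j) then g i else 0) +
        ∑ k ∈ leftSet u⁻¹ j, g (i.succAbove k) := by
  rw [← Finset.sum_ite_mem_eq, Fin.sum_univ_succAbove _ i, ← Finset.sum_ite_mem_eq (leftSet u⁻¹ j)]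
  simp only [succAbove_mem_leftSet]

theorem sum_rightSet_succAbove (g : Fin (n + 1) → ℝ) :
    ∑ k ∈ rightSet (insertPerm i u)⁻¹ (i.succAbove j), g k =
      (if i ∈ rightSet (insertPerm i u)⁻¹ (i.succAbove j) then g i else 0) +
        ∑ k ∈ rightSet u⁻¹ j, g (i.succAbove k) := by
  rw [← Finset.sum_ite_mem_eq, Fin.sum_univ_succAbove _ i, ← Finset.sum_ite_mem_eq (rightSet u⁻¹ j)]
  simp only [succAbove_mem_rightSet]

end Sets

/-! ### Merging two entries and the recursion for slacks -/

/-- Replace the two neighbouring entries number `i` and `i + 1` by their sum minus `x`. -/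
noncomputable def mergeAt {n : ℕ} (lam : Fin (n + 2) → ℝ) (i : Fin (n + 1)) (x : ℝ) :
    Fin (n + 1) → ℝ :=
  fun k => lam (i.castSucc.succAbove k) + if k = i then lam i.castSucc - x else 0

section MergeAt

variable {n : ℕ} (lam : Fin (n + 2) → ℝ) (i : Fin (n + 1)) (x : ℝ)

theorem succAbove_succ_of_ne {i k : Fin (n + 1)} (h : k ≠ i) :
    i.succ.succAbove k = i.castSucc.succAbove k := by
  rcases lt_or_gt_of_ne h with h | h
  · rw [Fin.succAbove_succ_of_le _ _ h.le, Fin.succAbove_castSucc_of_lt _ _ h]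
  · rw [Fin.succAbove_succ_of_lt _ _ h, Fin.succAbove_castSucc_of_le _ _ h.le]

/-- The merge is symmetric in its two entries; this form suits the right inequalities, whose bounds
are shifted by one. -/
theorem mergeAt_apply' (k : Fin (n + 1)) : mergeAt lam i x k =
    lam (i.succ.succAbove k) + if k = i then lam i.succ - x else 0 := by
  unfold mergeAt
  by_cases h : k = i
  · subst h
    simp
    ring
  · rw [if_neg h, if_neg h, succAbove_succ_of_ne h]

theorem mergeAt_castSucc : mergeAt lam i (lam i.castSucc) = lam ∘ i.castSucc.succAbove := by
  ext k
  simp [mergeAt]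

theorem mergeAt_succ : mergeAt lam i (lam i.succ) = lam ∘ i.succ.succAbove := by
  ext k
  simp [mergeAt_apply']

theorem sum_mergeAt : ∑ k, mergeAt lam i x k = ∑ k, lam k - x := by
  rw [Fin.sum_univ_succAbove lam i.castSucc]
  simp only [mergeAt, Finset.sum_add_distrib, Finset.sum_ite_eq', Finset.mem_univ, if_true]
  ring

variable {lam i x}

/-- The merged entry stays between the two entries it replaces. -/
theorem strictAnti_mergeAt (hlam : StrictAnti lam) (h1 : lam i.succ ≤ x)
    (h2 : x ≤ lam i.castSucc) : StrictAnti (mergeAt lam i x) := by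
  intro a b hab
  have ha : lam (i.castSucc.succAbove a) ≤ mergeAt lam i x a := by
    unfold mergeAt
    split_ifs <;> linarith
  have hb : mergeAt lam i x b ≤ lam (i.succ.succAbove b) := by
    rw [mergeAt_apply']
    split_ifs <;> linarith
  refine lt_of_le_of_lt hb (lt_of_lt_of_le (hlam ?_) ha)
  rw [Fin.lt_def] at hab
  simp only [Fin.succAbove, Fin.lt_def, Fin.val_castSucc, Fin.val_succ]
  split_ifs <;> simp <;> omega

end MergeAt

/-- The slack of the left inequality at the node labelled `k`. -/
noncomputable def leftSlack {r : ℕ} (lam : Fin (r + 1) → ℝ) (u : Equiv.Perm (Fin r))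
    (t : Fin (r + 1) → ℝ) (k : Fin r) : ℝ :=
  leftBound lam u⁻¹ (u k) - leftForm u⁻¹ (u k) t

/-- The slack of the right inequality at the node labelled `k`. -/
noncomputable def rightSlack {r : ℕ} (lam : Fin (r + 1) → ℝ) (u : Equiv.Perm (Fin r))
    (t : Fin (r + 1) → ℝ) (k : Fin r) : ℝ :=
  rightForm u⁻¹ (u k) t - rightBound lam u⁻¹ (u k)

section Slack

variable {n : ℕ} (lam : Fin (n + 2) → ℝ) (i : Fin (n + 1)) (u : Equiv.Perm (Fin n))
  (t : Fin (n + 2) → ℝ)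

theorem leftSlack_insertPerm_zero :
    leftSlack lam (insertPerm i u) t 0 = lam i.castSucc - t 0 := by
  simp [leftSlack, leftBound, leftForm, leftSet_insertPerm_self]

theorem rightSlack_insertPerm_zero :
    rightSlack lam (insertPerm i u) t 0 = t 0 - lam i.succ := by
  simp [rightSlack, rightBound, rightForm, rightSet_insertPerm_self]

theorem leftSlack_insertPerm_succ (k : Fin n) : leftSlack lam (insertPerm i u) t k.succ =
    leftSlack (mergeAt lam i (t 0)) u (Fin.tail t) k := by
  simp only [leftSlack, insertPerm_succ]
  generalize u k = j
  have hj : j ∉ leftSet u⁻¹ j := by simp [leftSet]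
  simp only [leftBound, leftForm, sum_leftSet_succAbove, insertPerm_inv_succAbove,
    insertPerm_inv_self, mergeAt, Finset.sum_add_distrib, Fin.tail, Fin.succ_castSucc,
    Fin.castSucc_succAbove_castSucc, Fin.castSucc_zero]
  -- Deleting the smallest letter from a run removes `λ_i` from the bound and `t_0` from the form.
  -- The correction `λ_i - t_0` in the merged entry enters the shorter bound in exactly those cases,
  -- by `self_mem_leftSet`.
  have key : ∀ c : ℝ, (if i ∈ leftSet (insertPerm i u)⁻¹ (i.succAbove j) then c else 0) =
      (if j.castSucc = i then c else 0) +
        ∑ k ∈ leftSet u⁻¹ j, if k.castSucc = i then c else 0 := by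
    intro c
    simp only [self_mem_leftSet]
    by_cases h : ∃ k : Fin n, k.castSucc = i
    · obtain ⟨k, rfl⟩ := h
      simp only [Fin.castSucc_inj, exists_eq_left, Finset.sum_ite_eq', eq_comm (a := j)]
      by_cases hk : k = j
      · simp [hk, hj]
      · simp [hk]
    · have h' : ∀ k : Fin n, k.castSucc ≠ i := fun k hk => h ⟨k, hk⟩
      simp [h']
  have hd := key (lam i.castSucc - t 0)
  have h1 : ∀ (p : Prop) [Decidable p], (if p then lam i.castSucc else 0) - (if p then t 0 else 0) =
      if p then lam i.castSucc - t 0 else 0 := fun p _ => by split_ifs <;> simp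
  rw [← h1] at hd
  linarith

theorem rightSlack_insertPerm_succ (k : Fin n) : rightSlack lam (insertPerm i u) t k.succ =
    rightSlack (mergeAt lam i (t 0)) u (Fin.tail t) k := by
  simp only [rightSlack, insertPerm_succ]
  generalize u k = j
  have hj : j ∉ rightSet u⁻¹ j := by simp [rightSet]
  simp only [rightBound, rightForm, sum_rightSet_succAbove, insertPerm_inv_succAbove,
    insertPerm_inv_self, mergeAt_apply', Finset.sum_add_distrib, Fin.tail, Fin.succ_castSucc,
    Fin.succ_succAbove_succ, Fin.castSucc_zero]
  have key : ∀ c : ℝ, (if i ∈ rightSet (insertPerm i u)⁻¹ (i.succAbove j) then c else 0) =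
      (if j.succ = i then c else 0) +
        ∑ k ∈ rightSet u⁻¹ j, if k.succ = i then c else 0 := by
    intro c
    simp only [self_mem_rightSet]
    by_cases h : ∃ k : Fin n, k.succ = i
    · obtain ⟨k, rfl⟩ := h
      simp only [Fin.succ_inj, exists_eq_left, Finset.sum_ite_eq', eq_comm (a := j)]
      by_cases hk : k = j
      · simp [hk, hj]
      · simp [hk]
    · have h' : ∀ k : Fin n, k.succ ≠ i := fun k hk => h ⟨k, hk⟩
      simp [h']
  have hd := key (lam i.succ - t 0)
  have h1 : ∀ (p : Prop) [Decidable p], (if p then lam i.succ else 0) - (if p then t 0 else 0) =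
      if p then lam i.succ - t 0 else 0 := fun p _ => by split_ifs <;> simp
  rw [← h1] at hd
  linarith

end Slack

/-! ### The polytope of the left and right inequalities -/

/-- The set cut out by the left and right inequalities. -/
def inequalityCube {r : ℕ} (lam : Fin (r + 1) → ℝ) (u : Equiv.Perm (Fin r)) :
    Set (Fin (r + 1) → ℝ) :=
  {t | ∑ k, t k = ∑ k, lam k ∧ ∀ k, 0 ≤ leftSlack lam u t k ∧ 0 ≤ rightSlack lam u t k}

theorem sum_eq_iff_tail {n : ℕ} (lam : Fin (n + 2) → ℝ) (i : Fin (n + 1)) (t : Fin (n + 2) → ℝ) :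
    ∑ k, t k = ∑ k, lam k ↔ ∑ k, Fin.tail t k = ∑ k, mergeAt lam i (t 0) k := by
  rw [sum_mergeAt, Fin.sum_univ_succ t, eq_sub_iff_add_eq, add_comm]
  rfl

theorem mem_inequalityCube_insertPerm {n : ℕ} {lam : Fin (n + 2) → ℝ} {i : Fin (n + 1)}
    {u : Equiv.Perm (Fin n)} {t : Fin (n + 2) → ℝ} :
    t ∈ inequalityCube lam (insertPerm i u) ↔ (lam i.succ ≤ t 0 ∧ t 0 ≤ lam i.castSucc) ∧
      Fin.tail t ∈ inequalityCube (mergeAt lam i (t 0)) u := by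
  simp only [inequalityCube, Set.mem_ofPred_eq, Fin.forall_fin_succ (n := n),
    leftSlack_insertPerm_zero, rightSlack_insertPerm_zero, leftSlack_insertPerm_succ,
    rightSlack_insertPerm_succ, sub_nonneg, ← sum_eq_iff_tail]
  tauto

/-- Coordinates are chosen one by one, `a k` fixing the relative position in the `k`-th segment. Its
length `g` is a gap of the merged sequence and so depends on earlier choices. -/
theorem exists_slack_eq {r : ℕ} {lam : Fin (r + 1) → ℝ} (hlam : StrictAnti lam)
    (u : Equiv.Perm (Fin r)) {a : Fin r → ℝ} (ha : ∀ k, 0 ≤ a k ∧ a k ≤ 1) :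
    ∃ t : Fin (r + 1) → ℝ, ∑ k, t k = ∑ k, lam k ∧
      ∀ k, ∃ g > 0, leftSlack lam u t k = a k * g ∧ rightSlack lam u t k = (1 - a k) * g := by
  induction r with
  | zero => exact ⟨lam, rfl, fun k => k.elim0⟩
  | succ r ih =>
    obtain ⟨i, u, rfl⟩ := exists_insertPerm u
    obtain ⟨ha0, ha1⟩ := ha 0
    have hg : 0 < lam i.castSucc - lam i.succ := sub_pos.2 (hlam Fin.castSucc_lt_succ)
    set x := lam i.castSucc - a 0 * (lam i.castSucc - lam i.succ) with hx
    have hx1 : lam i.succ ≤ x := by nlinarith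
    have hx2 : x ≤ lam i.castSucc := by nlinarith
    obtain ⟨t, hsum, ht⟩ := ih (strictAnti_mergeAt hlam hx1 hx2) u fun k => ha k.succ
    refine ⟨Fin.cons x t, ?_, fun k => ?_⟩
    · rw [sum_eq_iff_tail lam i]
      simpa using hsum
    · induction k using Fin.cases with
      | zero =>
        refine ⟨_, hg, ?_, ?_⟩
        · rw [leftSlack_insertPerm_zero, Fin.cons_zero, hx]
          ring
        · rw [rightSlack_insertPerm_zero, Fin.cons_zero, hx]
          ring
      | succ k =>
        rw [leftSlack_insertPerm_succ, rightSlack_insertPerm_succ, Fin.cons_zero, Fin.tail_cons]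
        exact ht k

theorem slack_add_pos {r : ℕ} {lam : Fin (r + 1) → ℝ} (hlam : StrictAnti lam)
    {u : Equiv.Perm (Fin r)} {t : Fin (r + 1) → ℝ} (ht : t ∈ inequalityCube lam u) (k : Fin r) :
    0 < leftSlack lam u t k + rightSlack lam u t k := by
  induction r with
  | zero => exact k.elim0
  | succ r ih =>
    obtain ⟨i, u, rfl⟩ := exists_insertPerm u
    rw [mem_inequalityCube_insertPerm] at ht
    induction k using Fin.cases with
    | zero =>
      rw [leftSlack_insertPerm_zero, rightSlack_insertPerm_zero]
      linarith [hlam (Fin.castSucc_lt_succ (i := i))]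
    | succ k =>
      rw [leftSlack_insertPerm_succ, rightSlack_insertPerm_succ]
      exact ih (strictAnti_mergeAt hlam ht.1.1 ht.1.2) ht.2 k

/-- The left form as a continuous linear functional. -/
noncomputable def leftFunctional {r : ℕ} (w : Equiv.Perm (Fin r)) (i : Fin r) :
    StrongDual ℝ (Fin (r + 1) → ℝ) :=
  ContinuousLinearMap.proj (w i).castSucc +
    ∑ j ∈ leftSet w i, ContinuousLinearMap.proj (w j).castSucc

/-- The right form as a continuous linear functional. -/
noncomputable def rightFunctional {r : ℕ} (w : Equiv.Perm (Fin r)) (i : Fin r) :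
    StrongDual ℝ (Fin (r + 1) → ℝ) :=
  ContinuousLinearMap.proj (w i).castSucc +
    ∑ j ∈ rightSet w i, ContinuousLinearMap.proj (w j).castSucc

theorem leftFunctional_apply {r : ℕ} (w : Equiv.Perm (Fin r)) (i : Fin r) (t : Fin (r + 1) → ℝ) :
    leftFunctional w i t = leftForm w i t := by
  simp [leftFunctional, leftForm]

theorem rightFunctional_apply {r : ℕ} (w : Equiv.Perm (Fin r)) (i : Fin r) (t : Fin (r + 1) → ℝ) :
    rightFunctional w i t = rightForm w i t := by
  simp [rightFunctional, rightForm]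

/-- The functionals of the left and right inequalities, written as upper bounds. -/
noncomputable def cubeFunctional {r : ℕ} (w : Equiv.Perm (Fin r)) :
    Fin r ⊕ Fin r → StrongDual ℝ (Fin (r + 1) → ℝ) :=
  Sum.elim (leftFunctional w) fun i => -rightFunctional w i

/-- The bounds of the left and right inequalities, written as upper bounds. -/
noncomputable def cubeBound {r : ℕ} (lam : Fin (r + 1) → ℝ) (w : Equiv.Perm (Fin r)) :
    Fin r ⊕ Fin r → ℝ :=
  Sum.elim (leftBound lam w) fun i => -rightBound lam w i

theorem cubeFunctional_inl {r : ℕ} {lam : Fin (r + 1) → ℝ} {u : Equiv.Perm (Fin r)}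
    {t : Fin (r + 1) → ℝ} {k : Fin r} :
    cubeFunctional u⁻¹ (.inl (u k)) t = cubeBound lam u⁻¹ (.inl (u k)) - leftSlack lam u t k := by
  simp [cubeFunctional, cubeBound, leftFunctional_apply, leftSlack]

theorem cubeFunctional_inr {r : ℕ} {lam : Fin (r + 1) → ℝ} {u : Equiv.Perm (Fin r)}
    {t : Fin (r + 1) → ℝ} {k : Fin r} :
    cubeFunctional u⁻¹ (.inr (u k)) t = cubeBound lam u⁻¹ (.inr (u k)) - rightSlack lam u t k := by
  simp [cubeFunctional, cubeBound, rightFunctional_apply, rightSlack]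
  ring

theorem isCubeSystem_inequalityCube {r : ℕ} {lam : Fin (r + 1) → ℝ} (hlam : StrictAnti lam)
    (u : Equiv.Perm (Fin r)) :
    IsCubeSystem (inequalityCube lam u) (cubeFunctional u⁻¹) (cubeBound lam u⁻¹) where
  mem_iff := by
    refine ⟨∑ k, LinearMap.proj k, ∑ k, lam k, fun t => ?_⟩
    have hφ : (∑ k, LinearMap.proj k : (Fin (r + 1) → ℝ) →ₗ[ℝ] ℝ) t = ∑ k, t k := by simp
    have hl : (∀ i, cubeFunctional u⁻¹ (.inl i) t ≤ cubeBound lam u⁻¹ (.inl i)) ↔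
        ∀ k, 0 ≤ leftSlack lam u t k := by
      rw [u.surjective.forall]
      simp only [cubeFunctional_inl (lam := lam), sub_le_self_iff]
    have hr : (∀ i, cubeFunctional u⁻¹ (.inr i) t ≤ cubeBound lam u⁻¹ (.inr i)) ↔
        ∀ k, 0 ≤ rightSlack lam u t k := by
      rw [u.surjective.forall]
      simp only [cubeFunctional_inr (lam := lam), sub_le_self_iff]
    rw [hφ, Sum.forall, hl, hr, ← forall_and]
    rfl
  not_both t ht i := by
    obtain ⟨k, rfl⟩ := u.surjective i
    have := slack_add_pos hlam ht k
    rw [cubeFunctional_inl (lam := lam), cubeFunctional_inr (lam := lam)]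
    intro h1 h2
    linarith
  exists_tight T hT := by
    classical
    -- Ratio `0` makes the left inequality tight, `1` the right one, and `1 / 2` neither.
    obtain ⟨t, hsum, ht⟩ := exists_slack_eq hlam u (a := fun k =>
      if .inl (u k) ∈ T then 0 else if .inr (u k) ∈ T then 1 else 1 / 2)
      (fun k => by split_ifs <;> norm_num)
    refine ⟨t, ⟨hsum, fun k => ?_⟩, ?_⟩
    · obtain ⟨g, hg, h1, h2⟩ := ht k
      rw [h1, h2]
      split_ifs <;> constructor <;> linarith
    · rintro (i | i) <;> obtain ⟨k, rfl⟩ := u.surjective i <;> obtain ⟨g, hg, h1, h2⟩ := ht k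
      · rw [cubeFunctional_inl (lam := lam), h1]
        split_ifs <;> simp_all [hg.ne']
      · rw [cubeFunctional_inr (lam := lam), h2]
        split_ifs with h3 h4
        · simp [hT _ h3, hg.ne']
        · simp [h4]
        · simp only [h4, iff_false]
          intro h
          linarith

/-! ### The cubes are cut out by the inequalities -/

theorem permPoint_insertPerm {n : ℕ} (lam : Fin (n + 2) → ℝ) (p : Fin (n + 2))
    (v : Equiv.Perm (Fin (n + 1))) :
    permPoint lam (insertPerm p v) = Fin.cons (lam p) (permPoint (lam ∘ p.succAbove) v) := by
  ext j
  induction j using Fin.cases <;> simp [permPoint]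

theorem permPoint_mem_inequalityCube {r : ℕ} {lam : Fin (r + 1) → ℝ} (hlam : StrictAnti lam)
    {u : Equiv.Perm (Fin r)} {v : Equiv.Perm (Fin (r + 1))} (hv : v ∈ bruhatInterval u) :
    permPoint lam v ∈ inequalityCube lam u := by
  induction r with
  | zero => exact ⟨Equiv.sum_comp v lam, fun k => k.elim0⟩
  | succ r ih =>
    obtain ⟨i, u, rfl⟩ := exists_insertPerm u
    obtain ⟨p, v, rfl⟩ := exists_insertPerm v
    obtain ⟨hp, hv⟩ := insertPerm_mem_bruhatInterval.1 hv
    have hlt := hlam (Fin.castSucc_lt_succ (i := i))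
    rw [mem_inequalityCube_insertPerm, permPoint_insertPerm, Fin.cons_zero, Fin.tail_cons]
    have hmem : lam i.succ ≤ lam p ∧ lam p ≤ lam i.castSucc := by
      rcases hp with rfl | rfl
      · exact ⟨hlt.le, le_rfl⟩
      · exact ⟨le_rfl, hlt.le⟩
    -- At either end of the segment, merging just deletes the entry used as first coordinate.
    have hmerge : mergeAt lam i (lam p) = lam ∘ p.succAbove := by
      rcases hp with rfl | rfl
      · exact mergeAt_castSucc lam i
      · exact mergeAt_succ lam i
    refine ⟨hmem, ?_⟩
    rw [← hmerge]
    exact ih (strictAnti_mergeAt hlam hmem.1 hmem.2) hv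

theorem inequalityCube_subset_cube {r : ℕ} {lam : Fin (r + 1) → ℝ} (hlam : StrictAnti lam)
    (u : Equiv.Perm (Fin r)) : inequalityCube lam u ⊆ cube lam u := by
  induction r with
  | zero =>
    intro t ht
    refine subset_convexHull ℝ _ ⟨embed u, ⟨Relation.ReflTransGen.refl, ?_⟩, ?_⟩
    · have : Subsingleton (Fin (0 + 1)) := inferInstanceAs (Subsingleton (Fin 1))
      rw [Subsingleton.elim (longCycle 0 * embed u) (embed u)]
      exact Relation.ReflTransGen.refl
    · have h := ht.1
      rw [Fin.sum_univ_one, Fin.sum_univ_one] at h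
      ext j
      rw [Fin.fin_one_eq_zero j, h, permPoint, Fin.fin_one_eq_zero (embed u 0)]
  | succ r ih =>
    intro t ht
    obtain ⟨i, u, rfl⟩ := exists_insertPerm u
    obtain ⟨⟨h1, h2⟩, ht⟩ := mem_inequalityCube_insertPerm.1 ht
    have htail := ih (strictAnti_mergeAt hlam h1 h2) u ht
    rw [← Fin.cons_self_tail t]
    generalize t 0 = x at *
    generalize Fin.tail t = y at *
    -- By convexity of the slice at `x`, only the generating points of the smaller cube need
    -- checking.
    have hconv : Convex ℝ {y | (Fin.cons x y : Fin (r + 2) → ℝ) ∈ cube lam (insertPerm i u)} := by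
      intro y hy z hz a b ha hb hab
      have heq : (Fin.cons x (a • y + b • z) : Fin (r + 2) → ℝ) =
          a • Fin.cons x y + b • Fin.cons x z := by
        ext j
        induction j using Fin.cases with
        | zero => simp [← add_mul, hab]
        | succ j => simp
      rw [Set.mem_ofPred_eq, heq]
      exact convex_convexHull ℝ _ hy hz ha hb hab
    refine convexHull_min ?_ hconv htail
    rintro _ ⟨v, hv, rfl⟩
    obtain ⟨a, b, ha, hb, hab, hx⟩ := (Set.mem_Icc.2 ⟨h1, h2⟩ : x ∈ Set.Icc _ _) |>
      (Icc_subset_segment (𝕜 := ℝ) ·)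
    have hmem : ∀ p, p = i.castSucc ∨ p = i.succ →
        permPoint lam (insertPerm p v) ∈ cube lam (insertPerm i u) := fun p hp =>
      subset_convexHull ℝ _ ⟨_, insertPerm_mem_bruhatInterval.2 ⟨hp, hv⟩, rfl⟩
    -- `mergeAt` is affine in `x`, so this point divides the segment between two generating points
    -- in the ratio in which `x` divides its interval.
    suffices heq : (Fin.cons x (permPoint (mergeAt lam i x) v) : Fin (r + 2) → ℝ) =
        a • permPoint lam (insertPerm i.succ v) + b • permPoint lam (insertPerm i.castSucc v) by
      rw [Set.mem_ofPred_eq, heq]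
      exact convex_convexHull ℝ _ (hmem _ (Or.inr rfl)) (hmem _ (Or.inl rfl)) ha hb hab
    rw [permPoint_insertPerm, permPoint_insertPerm]
    ext j
    induction j using Fin.cases with
    | zero => simpa using hx.symm
    | succ j =>
      simp only [permPoint, Fin.cons_succ, Pi.add_apply, Pi.smul_apply, smul_eq_mul,
        Function.comp_apply]
      generalize v j = k
      simp only [smul_eq_mul] at hx
      by_cases hk : k = i
      · subst hk
        simp only [mergeAt, Fin.succAbove_castSucc_self, Fin.succAbove_succ_self, if_true]
        rw [← hx]
        linear_combination -(lam k.succ + lam k.castSucc) * hab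
      · rw [succAbove_succ_of_ne hk, ← add_mul, hab, one_mul, mergeAt, if_neg hk, add_zero]

theorem cube_eq_inequalityCube {r : ℕ} {lam : Fin (r + 1) → ℝ} (hlam : StrictAnti lam)
    (u : Equiv.Perm (Fin r)) : cube lam u = inequalityCube lam u := by
  refine Set.Subset.antisymm (convexHull_min ?_ (isCubeSystem_inequalityCube hlam u).convex)
    (inequalityCube_subset_cube hlam u)
  rintro _ ⟨v, hv, rfl⟩
  exact permPoint_mem_inequalityCube hlam hv

/-! ### The cubes cover the permutahedron -/

/-- The sum of the first `m` entries. -/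
noncomputable def prefixSum {n : ℕ} (lam : Fin n → ℝ) (m : ℕ) : ℝ :=
  ∑ k : Fin n, if (k : ℕ) < m then lam k else 0

theorem sum_le_prefixSum {n : ℕ} {lam : Fin n → ℝ} (hlam : Antitone lam) (B : Finset (Fin n)) :
    ∑ k ∈ B, lam k ≤ prefixSum lam B.card := by
  classical
  set I : Finset (Fin n) := Finset.univ.filter fun k => (k : ℕ) < B.card with hI
  have hBn : B.card ≤ n := by simpa using B.card_le_univ
  have hIB : I.card = B.card := by rw [hI, Fin.card_filter_val_lt, min_eq_right hBn]
  rw [prefixSum, ← Finset.sum_filter, ← hI, ← Finset.sum_inter_add_sum_sdiff B I,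
    ← Finset.sum_inter_add_sum_sdiff I B, Finset.inter_comm]
  refine add_le_add_right ?_ _
  rcases hBn.eq_or_lt with h | h
  · have hB : B = Finset.univ := by rwa [← Finset.card_eq_iff_eq_univ, Fintype.card_fin]
    have hI' : I = Finset.univ := by
      rwa [← Finset.card_eq_iff_eq_univ, Fintype.card_fin, hIB]
    rw [hB, hI']
  -- The two differences have equal size, and the entry with index `B.card` separates their values.
  · calc ∑ k ∈ B \ I, lam k ≤ (B \ I).card • lam ⟨B.card, h⟩ := by
          refine Finset.sum_le_card_nsmul _ _ _ fun k hk => hlam ?_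
          simpa [hI, Fin.le_def] using (Finset.mem_sdiff.1 hk).2
      _ = (I \ B).card • lam ⟨B.card, h⟩ := by rw [Finset.card_sdiff_comm hIB.symm]
      _ ≤ ∑ k ∈ I \ B, lam k := by
          refine Finset.card_nsmul_le_sum _ _ _ fun k hk => hlam ?_
          have := (Finset.mem_sdiff.1 hk).1
          simp only [hI, Finset.mem_filter] at this
          exact this.2.le

/-- The outer description of the permutahedron. -/
def IsMajorizedBy {n : ℕ} (t lam : Fin n → ℝ) : Prop :=
  ∑ k, t k = ∑ k, lam k ∧ ∀ A : Finset (Fin n), ∑ k ∈ A, t k ≤ prefixSum lam A.card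

/-- The easy half of Rado's theorem suffices: majorized points are placed directly in cubes. -/
theorem isMajorizedBy_of_mem_permutahedron {n : ℕ} {lam : Fin n → ℝ} (hlam : Antitone lam)
    {t : Fin n → ℝ} (ht : t ∈ permutahedron lam) : IsMajorizedBy t lam := by
  refine convexHull_min (t := {t | IsMajorizedBy t lam}) ?_ ?_ ht
  · rintro _ ⟨v, rfl⟩
    refine ⟨Equiv.sum_comp v lam, fun A => ?_⟩
    have := sum_le_prefixSum hlam (A.map v.toEmbedding)
    rwa [Finset.sum_map, Finset.card_map] at this
  · rintro x ⟨hx, hx'⟩ y ⟨hy, hy'⟩ a b ha hb hab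
    have hs : ∀ A : Finset (Fin n), ∑ k ∈ A, (a • x + b • y) k =
        a * ∑ k ∈ A, x k + b * ∑ k ∈ A, y k := fun A => by
      simp [Finset.sum_add_distrib, Finset.mul_sum]
    refine ⟨?_, fun A => ?_⟩
    · rw [hs, hx, hy, ← add_mul, hab, one_mul]
    · rw [hs]
      calc _ ≤ a * prefixSum lam A.card + b * prefixSum lam A.card := by
            gcongr
            exacts [hx' A, hy' A]
        _ = prefixSum lam A.card := by rw [← add_mul, hab, one_mul]

theorem prefixSum_mergeAt_of_le {n : ℕ} (lam : Fin (n + 2) → ℝ) (i : Fin (n + 1)) (x : ℝ) {m : ℕ}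
    (hm : m ≤ i) : prefixSum (mergeAt lam i x) m = prefixSum lam m := by
  rw [prefixSum, prefixSum, Fin.sum_univ_succAbove _ i.castSucc, if_neg (by simpa using hm),
    zero_add]
  refine Finset.sum_congr rfl fun k _ => ?_
  by_cases hk : k < i
  · rw [Fin.succAbove_castSucc_of_lt _ _ hk, mergeAt, if_neg hk.ne, add_zero,
      Fin.succAbove_castSucc_of_lt _ _ hk, Fin.val_castSucc]
  · rw [Fin.succAbove_castSucc_of_le _ _ (not_lt.1 hk), Fin.val_succ]
    have : (i : ℕ) ≤ k := not_lt.1 hk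
    rw [if_neg (by omega), if_neg (by omega)]

theorem prefixSum_mergeAt_of_lt {n : ℕ} (lam : Fin (n + 2) → ℝ) (i : Fin (n + 1)) (x : ℝ) {m : ℕ}
    (hm : i < m) : prefixSum (mergeAt lam i x) m = prefixSum lam (m + 1) - x := by
  have h : ∀ k : Fin (n + 1), (i.castSucc.succAbove k : ℕ) < m + 1 ↔ (k : ℕ) < m := by
    intro k
    by_cases hk : k < i
    · rw [Fin.succAbove_castSucc_of_lt _ _ hk, Fin.val_castSucc]
      have : (k : ℕ) < i := hk
      omega
    · rw [Fin.succAbove_castSucc_of_le _ _ (not_lt.1 hk), Fin.val_succ, Nat.succ_lt_succ_iff]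
  have h' : ∀ k : Fin (n + 1), (if (k : ℕ) < m then mergeAt lam i x k else 0) =
      (if (k : ℕ) < m then lam (i.castSucc.succAbove k) else 0) +
        if k = i then lam i.castSucc - x else 0 := by
    intro k
    by_cases hk : k = i
    · subst hk
      simp [mergeAt, hm]
    · simp [mergeAt, hk]
  rw [prefixSum, prefixSum, Fin.sum_univ_succAbove _ i.castSucc,
    if_pos (by rw [Fin.val_castSucc]; omega)]
  simp only [h, h', Finset.sum_add_distrib, Finset.sum_ite_eq', Finset.mem_univ, if_true]
  ring

theorem exists_mem_inequalityCube {r : ℕ} {lam : Fin (r + 1) → ℝ} (hlam : StrictAnti lam)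
    {t : Fin (r + 1) → ℝ} (ht : IsMajorizedBy t lam) : ∃ u, t ∈ inequalityCube lam u := by
  classical
  induction r with
  | zero => exact ⟨1, ht.1, fun k => k.elim0⟩
  | succ r ih =>
    have h0 : t 0 ≤ lam 0 := by
      have := ht.2 {0}
      rw [Finset.sum_singleton, Finset.card_singleton, prefixSum, Fin.sum_univ_succ] at this
      simpa using this
    have hlast : lam (Fin.last (r + 1)) ≤ t 0 := by
      have h1 := ht.2 (Finset.univ.erase 0)
      have h2 := Finset.add_sum_erase Finset.univ t (Finset.mem_univ 0)
      have h3 := ht.1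
      rw [Finset.card_erase_of_mem (Finset.mem_univ 0), Finset.card_univ, Fintype.card_fin,
        prefixSum, Fin.sum_univ_castSucc] at h1
      rw [Fin.sum_univ_castSucc lam] at h3
      have h4 : ∀ k : Fin (r + 1), (k : ℕ) ≤ r := fun k => Nat.lt_succ_iff.1 k.2
      simp [h4] at h1
      linarith
    -- The singleton `{0}` and its complement bound `t 0` by the extreme entries, so it falls
    -- between two consecutive ones.
    obtain ⟨i, hi1, hi2⟩ : ∃ i : Fin (r + 1), lam i.succ ≤ t 0 ∧ t 0 ≤ lam i.castSucc := by
      by_contra! hcon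
      have hall : ∀ k, t 0 ≤ lam k := fun k => by
        induction k using Fin.induction with
        | zero => exact h0
        | succ i ih => exact (not_lt.1 fun h => (hcon i h.le).not_ge ih)
      rw [← Fin.succ_last] at hlast
      exact (hcon _ hlast).not_ge (hall _)
    have hmaj : IsMajorizedBy (Fin.tail t) (mergeAt lam i (t 0)) := by
      refine ⟨(sum_eq_iff_tail lam i t).1 ht.1, fun A => ?_⟩
      have hA : ∑ k ∈ A, Fin.tail t k = ∑ k ∈ A.map (Fin.succEmb (r + 1)), t k := by
        rw [Finset.sum_map]
        rfl
      -- Short prefixes miss the merged entry, and the bound for `A` suffices; longer ones contain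
      -- it, and the bound for `A` together with `0` is used.
      by_cases hm : A.card ≤ i
      · rw [prefixSum_mergeAt_of_le _ _ _ hm, hA]
        simpa using ht.2 (A.map (Fin.succEmb (r + 1)))
      · rw [prefixSum_mergeAt_of_lt _ _ _ (not_le.1 hm), hA]
        have hn : (0 : Fin (r + 2)) ∉ A.map (Fin.succEmb (r + 1)) := by simp
        have := ht.2 (Finset.cons 0 _ hn)
        rw [Finset.sum_cons, Finset.card_cons, Finset.card_map] at this
        linarith
    obtain ⟨u, hu⟩ := ih (strictAnti_mergeAt hlam hi1 hi2) hmaj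
    exact ⟨insertPerm i u, mem_inequalityCube_insertPerm.2 ⟨⟨hi1, hi2⟩, hu⟩⟩

theorem permutahedron_eq_iUnion_cube {r : ℕ} {lam : Fin (r + 1) → ℝ} (hlam : StrictAnti lam) :
    permutahedron lam = ⋃ u, cube lam u := by
  refine Set.Subset.antisymm (fun t ht => ?_)
    (Set.iUnion_subset fun u => convexHull_mono (Set.image_subset_range _ _))
  obtain ⟨u, hu⟩ := exists_mem_inequalityCube hlam
    (isMajorizedBy_of_mem_permutahedron hlam.antitone ht)
  exact Set.mem_iUnion.2 ⟨u, inequalityCube_subset_cube hlam u hu⟩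

/-! ### Intersections of cubes -/

/-- `L` and `R` must not depend on `lam`, because the induction applies to merged sequences that
vary with `t 0`. -/
theorem exists_inter_iff_tight {r : ℕ} (u u' : Equiv.Perm (Fin r)) : ∃ L R : Fin r → Prop,
    ∀ lam : Fin (r + 1) → ℝ, StrictAnti lam → ∀ t ∈ inequalityCube lam u,
      (t ∈ inequalityCube lam u' ↔
        (∀ k, L k → leftSlack lam u t k = 0) ∧ ∀ k, R k → rightSlack lam u t k = 0) := by
  induction r with
  | zero =>
    refine ⟨fun _ => True, fun _ => True, fun lam _ t ht => ?_⟩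
    rw [Subsingleton.elim u' u]
    exact ⟨fun _ => ⟨fun k => k.elim0, fun k => k.elim0⟩, fun _ => ht⟩
  | succ r ih =>
    obtain ⟨i, u, rfl⟩ := exists_insertPerm u
    obtain ⟨i', u', rfl⟩ := exists_insertPerm u'
    obtain ⟨L, R, H⟩ := ih u u'
    -- Neighbouring intervals for `t 0` share one endpoint, which one tight inequality selects.
    -- Distant ones are disjoint; this is encoded by asking for both inequalities to be tight, which
    -- is impossible.
    refine ⟨Fin.cons (i' < i ∨ (i : ℕ) + 1 < i') L, Fin.cons (i < i' ∨ (i' : ℕ) + 1 < i) R,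
      fun lam hlam t ht => ?_⟩
    rw [mem_inequalityCube_insertPerm] at ht ⊢
    have hH := H _ (strictAnti_mergeAt hlam ht.1.1 ht.1.2) _ ht.2
    have hlt := hlam (Fin.castSucc_lt_succ (i := i))
    have hlt' := hlam (Fin.castSucc_lt_succ (i := i'))
    simp only [Fin.forall_fin_succ (n := r), Fin.cons_zero, Fin.cons_succ,
      leftSlack_insertPerm_zero, rightSlack_insertPerm_zero, leftSlack_insertPerm_succ,
      rightSlack_insertPerm_succ, sub_eq_zero]
    rcases lt_trichotomy i i' with h | rfl | h
    · have hi : (i : ℕ) < i' := h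
      by_cases hfar : (i : ℕ) + 1 < i'
      · have hlt2 : lam i'.castSucc < lam i.succ := hlam hfar
        constructor
        · rintro ⟨h1, -⟩
          linarith [h1.2, ht.1.1]
        · rintro ⟨⟨h1, -⟩, h2, -⟩
          linarith [h1 (Or.inr hfar), h2 (Or.inl h)]
      · have he : i'.castSucc = i.succ := by
          ext
          rw [Fin.val_castSucc, Fin.val_succ]
          omega
        -- At the common endpoint both merges delete the same entry, so the tails are compared over
        -- one sequence.
        have hm : t 0 = lam i.succ → mergeAt lam i' (t 0) = mergeAt lam i (t 0) := fun h0 => by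
          rw [h0, mergeAt_succ, ← he, mergeAt_castSucc]
        rw [he] at hlt' ⊢
        constructor
        · rintro ⟨h1, h2⟩
          have h0 := le_antisymm h1.2 ht.1.1
          rw [hm h0] at h2
          exact ⟨⟨fun h' => by omega, (hH.1 h2).1⟩, fun _ => h0, (hH.1 h2).2⟩
        · rintro ⟨⟨-, h1⟩, h2, h3⟩
          have h0 := h2 (Or.inl h)
          rw [hm h0]
          exact ⟨by rw [h0]; exact ⟨hlt'.le, le_rfl⟩, hH.2 ⟨h1, h3⟩⟩
    · rw [hH]
      simp [ht.1]
    · have hi : (i' : ℕ) < i := h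
      by_cases hfar : (i' : ℕ) + 1 < i
      · have hlt2 : lam i.castSucc < lam i'.succ := hlam hfar
        constructor
        · rintro ⟨h1, -⟩
          linarith [h1.1, ht.1.2]
        · rintro ⟨⟨h1, -⟩, h2, -⟩
          linarith [h1 (Or.inl h), h2 (Or.inr hfar)]
      · have he : i'.succ = i.castSucc := by
          ext
          rw [Fin.val_castSucc, Fin.val_succ]
          omega
        have hm : t 0 = lam i.castSucc → mergeAt lam i' (t 0) = mergeAt lam i (t 0) := fun h0 => by
          rw [h0, mergeAt_castSucc, ← he, mergeAt_succ]
        rw [he] at hlt' ⊢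
        constructor
        · rintro ⟨h1, h2⟩
          have h0 := le_antisymm ht.1.2 h1.1
          rw [hm h0] at h2
          exact ⟨⟨fun _ => h0.symm, (hH.1 h2).1⟩, fun h' => by omega, (hH.1 h2).2⟩
        · rintro ⟨⟨h2, h1⟩, -, h3⟩
          have h0 := (h2 (Or.inl h)).symm
          rw [hm h0]
          exact ⟨by rw [h0]; exact ⟨le_rfl, hlt'.le⟩, hH.2 ⟨h1, h3⟩⟩

/-- A first coordinate strictly between consecutive entries determines `i`; the tail is then treated
in the same way. -/
theorem eq_of_mem_of_slack_pos {r : ℕ} {lam : Fin (r + 1) → ℝ} (hlam : StrictAnti lam)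
    {u u' : Equiv.Perm (Fin r)} {t : Fin (r + 1) → ℝ} (ht : t ∈ inequalityCube lam u)
    (hpos : ∀ k, 0 < leftSlack lam u t k ∧ 0 < rightSlack lam u t k)
    (ht' : t ∈ inequalityCube lam u') : u = u' := by
  induction r with
  | zero => exact Subsingleton.elim _ _
  | succ r ih =>
    obtain ⟨i, u, rfl⟩ := exists_insertPerm u
    obtain ⟨i', u', rfl⟩ := exists_insertPerm u'
    rw [mem_inequalityCube_insertPerm] at ht ht'
    simp only [Fin.forall_fin_succ (n := r), leftSlack_insertPerm_zero, rightSlack_insertPerm_zero,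
      leftSlack_insertPerm_succ, rightSlack_insertPerm_succ, sub_pos] at hpos
    have h1 : i.castSucc < i'.succ := hlam.lt_iff_gt.1 (ht'.1.1.trans_lt hpos.1.1)
    have h2 : i'.castSucc < i.succ := hlam.lt_iff_gt.1 (hpos.1.2.trans_le ht'.1.2)
    rw [Fin.castSucc_lt_succ_iff] at h1 h2
    obtain rfl := le_antisymm h1 h2
    rw [ih (strictAnti_mergeAt hlam ht.1.1 ht.1.2) ht.2 hpos.2 ht'.2]

theorem eq_of_cube_subset {r : ℕ} {lam : Fin (r + 1) → ℝ} (hlam : StrictAnti lam)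
    {u u' : Equiv.Perm (Fin r)} (h : cube lam u ⊆ cube lam u') : u = u' := by
  obtain ⟨t, hsum, ht⟩ := exists_slack_eq hlam u (a := fun _ => 1 / 2) (by norm_num)
  have hpos : ∀ k, 0 < leftSlack lam u t k ∧ 0 < rightSlack lam u t k := fun k => by
    obtain ⟨g, hg, h1, h2⟩ := ht k
    rw [h1, h2]
    constructor <;> linarith
  have hmem : t ∈ inequalityCube lam u := ⟨hsum, fun k => ⟨(hpos k).1.le, (hpos k).2.le⟩⟩
  rw [cube_eq_inequalityCube hlam, cube_eq_inequalityCube hlam] at h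
  exact eq_of_mem_of_slack_pos hlam hmem hpos (h hmem)

/-! ### The polyhedral complex formed by the cubes -/

theorem isCubeSystem_cube {r : ℕ} {lam : Fin (r + 1) → ℝ} (hlam : StrictAnti lam)
    (u : Equiv.Perm (Fin r)) :
    IsCubeSystem (cube lam u) (cubeFunctional u⁻¹) (cubeBound lam u⁻¹) := by
  rw [cube_eq_inequalityCube hlam]
  exact isCubeSystem_inequalityCube hlam u

theorem isFace_cube_inter {r : ℕ} {lam : Fin (r + 1) → ℝ} (hlam : StrictAnti lam)
    (u u' : Equiv.Perm (Fin r)) : IsFace (cube lam u) (cube lam u ∩ cube lam u') := by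
  obtain ⟨L, R, H⟩ := exists_inter_iff_tight u u'
  have heq : cube lam u ∩ cube lam u' = tightFace (cube lam u) (cubeFunctional u⁻¹)
      (cubeBound lam u⁻¹) {j | Sum.elim (fun i => L (u⁻¹ i)) (fun i => R (u⁻¹ i)) j} := by
    ext t
    simp only [Set.mem_inter_iff, tightFace, Set.mem_ofPred_eq]
    refine and_congr_right fun ht => ?_
    rw [cube_eq_inequalityCube hlam] at ht ⊢
    rw [H lam hlam t ht, Sum.forall]
    refine and_congr (u.forall_congr fun k => ?_) (u.forall_congr fun k => ?_)
    · simp [cubeFunctional_inl (lam := lam)]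
    · simp [cubeFunctional_inr (lam := lam)]
  rw [heq]
  exact (isCubeSystem_cube hlam u).isExposed_tightFace _

theorem isPolytope_cube {r : ℕ} (lam : Fin (r + 1) → ℝ) (u : Equiv.Perm (Fin r)) :
    IsPolytope (cube lam u) :=
  ⟨_, Set.toFinite _, rfl⟩

/-- The complex of all faces of the cubes. -/
def cubeComplex {r : ℕ} (lam : Fin (r + 1) → ℝ) : Set (Set (Fin (r + 1) → ℝ)) :=
  {G | ∃ u, IsFace (cube lam u) G}

theorem isPolyhedralSubdivision_cubeComplex {r : ℕ} {lam : Fin (r + 1) → ℝ}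
    (hlam : StrictAnti lam) : IsPolyhedralSubdivision (permutahedron lam) (cubeComplex lam) := by
  -- Cutting `H` down to the common face of the two cubes makes it a face of the first cube, by
  -- transitivity; there it can be intersected with `G`.
  have hinter : ∀ u u' G H, IsFace (cube lam u) G → IsFace (cube lam u') H →
      IsFace G (G ∩ H) := by
    intro u u' G H hG hH
    have hD : IsExposed ℝ (cube lam u) (cube lam u ∩ cube lam u') := isFace_cube_inter hlam u u'
    have hD' : IsExposed ℝ (cube lam u') (cube lam u ∩ cube lam u') := by
      rw [Set.inter_comm]
      exact isFace_cube_inter hlam u' u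
    have hHD : IsExposed ℝ (cube lam u') (H ∩ (cube lam u ∩ cube lam u')) :=
      IsExposed.inter hH hD'
    have hHu : IsExposed ℝ (cube lam u) (H ∩ (cube lam u ∩ cube lam u')) :=
      (isCubeSystem_cube hlam u).isExposed_trans hD
        (hHD.mono Set.inter_subset_right Set.inter_subset_right)
    have hGH : G ∩ H = G ∩ (H ∩ (cube lam u ∩ cube lam u')) := by
      ext x
      have h1 : x ∈ G → x ∈ cube lam u := fun hx => IsExposed.subset hG hx
      have h2 : x ∈ H → x ∈ cube lam u' := fun hx => IsExposed.subset hH hx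
      simp only [Set.mem_inter_iff]
      tauto
    rw [hGH]
    exact (IsExposed.inter hG hHu).mono (IsExposed.subset hG) Set.inter_subset_left
  refine ⟨?_, ?_, ?_, ?_, ?_⟩
  · have : cubeComplex lam = ⋃ u, {G | IsExposed ℝ (cube lam u) G} := by
      ext G
      simp [cubeComplex, IsFace]
    rw [this]
    exact Set.finite_iUnion fun u => (isCubeSystem_cube hlam u).finite_setOf_isExposed
  · rintro G ⟨u, hG⟩
    exact hG.isPolytope (isPolytope_cube lam u)
  · rintro G ⟨u, hG⟩ H hH
    exact ⟨u, (isCubeSystem_cube hlam u).isExposed_trans hG hH⟩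
  · rintro G ⟨u, hG⟩ H ⟨u', hH⟩
    refine ⟨hinter u u' G H hG hH, ?_⟩
    rw [Set.inter_comm]
    exact hinter u' u H G hH hG
  · rw [permutahedron_eq_iUnion_cube hlam]
    refine Set.Subset.antisymm (Set.sUnion_subset ?_) (Set.iUnion_subset fun u => ?_)
    · rintro G ⟨u, hG⟩
      exact (IsExposed.subset hG).trans (Set.subset_iUnion _ u)
    · exact Set.subset_sUnion_of_mem ⟨u, IsExposed.refl _⟩

theorem setOf_maximal_cubeComplex {r : ℕ} {lam : Fin (r + 1) → ℝ} (hlam : StrictAnti lam) :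
    {G | Maximal (fun H => H ∈ cubeComplex lam) G} = Set.range (cube lam) := by
  ext G
  constructor
  · rintro ⟨⟨u, hG⟩, hmax⟩
    have hsub := IsExposed.subset hG
    exact ⟨u, Set.Subset.antisymm (hmax ⟨u, IsExposed.refl _⟩ hsub) hsub⟩
  · rintro ⟨u, rfl⟩
    refine ⟨⟨u, IsExposed.refl _⟩, ?_⟩
    rintro H ⟨u', hH⟩ hle
    obtain rfl := eq_of_cube_subset hlam (hle.trans (IsExposed.subset hH))
    exact IsExposed.subset hH

theorem tightSet_cube {r : ℕ} (lam : Fin (r + 1) → ℝ) (u w : Equiv.Perm (Fin r)) :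
    tightSet (cube lam u) lam w =
      fun j => tightFace (cube lam u) (cubeFunctional w) (cubeBound lam w) {j} := by
  ext (j | j) t
  · simp [tightSet, tightFace, cubeFunctional, cubeBound, leftFunctional_apply]
  · simp [tightSet, tightFace, cubeFunctional, cubeBound, rightFunctional_apply]

end CubeSubdivision

/-- The polytopes `Cube_λ(u)`, `u ∈ S_r`, are pairwise distinct combinatorial `r`-cubes, they are
the maximal faces of a polyhedral subdivision of `Perm(λ)`, and the facet description of
`Cube_λ(u)` is given by the left and right inequalities of `w = u⁻¹`: they cut it out in the
hyperplane `∑ t = ∑ λ`, and the `2r` of them define its facets, each facet exactly once. -/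
theorem theorem6p3 (r : ℕ) (hr : 1 ≤ r) (lam : Fin (r + 1) → ℝ) (hlam : StrictAnti lam) :
    Function.Injective (CubeSubdivision.cube lam) ∧
    (∀ u : Equiv.Perm (Fin r),
      CubeSubdivision.IsCombinatorialCube r (CubeSubdivision.cube lam u)) ∧
    (∃ K : Set (Set (Fin (r + 1) → ℝ)),
      CubeSubdivision.IsPolyhedralSubdivision (CubeSubdivision.permutahedron lam) K ∧
      {G | Maximal (fun H => H ∈ K) G} = Set.range (CubeSubdivision.cube lam)) ∧
    (∀ u : Equiv.Perm (Fin r),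
      CubeSubdivision.cube lam u =
        {t | ∑ k, t k = ∑ k, lam k ∧
          ∀ i : Fin r,
            CubeSubdivision.leftForm u⁻¹ i t ≤ CubeSubdivision.leftBound lam u⁻¹ i ∧
            CubeSubdivision.rightForm u⁻¹ i t ≥ CubeSubdivision.rightBound lam u⁻¹ i} ∧
      Function.Injective
        (CubeSubdivision.tightSet (CubeSubdivision.cube lam u) lam u⁻¹) ∧
      Set.range (CubeSubdivision.tightSet (CubeSubdivision.cube lam u) lam u⁻¹) =
        {G | CubeSubdivision.IsFacet (CubeSubdivision.cube lam u) G}) := by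
  -- With no inequalities at all, the empty face and the whole polytope would have the same tight
  -- set.
  have : Nonempty (Fin r) := ⟨⟨0, hr⟩⟩
  refine ⟨fun u u' h => CubeSubdivision.eq_of_cube_subset hlam h.subset, fun u => ?_,
    ⟨_, CubeSubdivision.isPolyhedralSubdivision_cubeComplex hlam,
      CubeSubdivision.setOf_maximal_cubeComplex hlam⟩, fun u => ⟨?_, ?_, ?_⟩⟩
  · exact ⟨CubeSubdivision.isPolytope_cube lam u,
      (CubeSubdivision.isCubeSystem_cube hlam u).combEquiv (CubeSubdivision.isCubeSystem_Icc r)⟩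
  · rw [CubeSubdivision.cube_eq_inequalityCube hlam]
    ext t
    refine and_congr_right fun _ => ?_
    refine u.forall_congr fun k => ?_
    simp only [CubeSubdivision.leftSlack, CubeSubdivision.rightSlack, sub_nonneg, ge_iff_le]
  · rw [CubeSubdivision.tightSet_cube]
    exact (CubeSubdivision.isCubeSystem_cube hlam u).tightFace_singleton_injective
  · rw [CubeSubdivision.tightSet_cube]
    ext G
    exact (CubeSubdivision.isCubeSystem_cube hlam u).isFacet_iff.symm
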